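/- Let $d\ge 1$, let $\Omega\subseteq\mathbb{R}^d$ be a bounded open set, let $a$ be a measurable, real, symmetric matrix field on $\Omega$ with $\lambda|\xi|^2\le \xi\cdot a\xi\le\Lambda|\xi|^2$ almost everywhere in $\Omega$ for all $\xi\in\mathbb{R}^d$, and let $q$ be a measurable real function with $\beta_1\le q\le\beta_2$ almost everywhere in $\Omega$, for some constants $\lambda,\Lambda,\beta_1,\beta_2>0$. (In particular this covers $d\in\{2,3\}$, $\Omega$ a bounded domain of class $C^{1,\alpha}$ and $a\in C^{0,\alpha}(\overline\Omega;\mathbb{R}^{d\times d})$.) Let $H^1_0(\Omega;\mathbb{C})$ be the closure of the test functions $C_c^\infty(\Omega;\mathbb{C})$ in $H^1(\Omega;\mathbb{C})$. The trace space is $H^{1/2}(\partial\Omega;\mathbb{C})=H^1(\Omega;\mathbb{C})/H^1_0(\Omega;\mathbb{C})$ and the trace operator $\gamma$ is the quotient map (for a bounded Lipschitz domain this is, up to the usual identification, the classical trace space with the classical trace). For $k\in\mathbb{C}$ and $\varphi\in H^{1/2}(\partial\Omega;\mathbb{C})$ consider the weak solutions $u\in H^1(\Omega;\mathbb{C})$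 of $$-\operatorname{div}(a\nabla u)-k\,q\,u=0\ \text{ in }\Omega,\qquad u=\varphi\ \text{ on }\partial\Omega,$$ that is, $\gamma(u)=\varphi$ and $\int_\Omega a\nabla u\cdot\nabla\psi\,dx-k\int_\Omega q\,u\,\psi\,dx=0$ for all $\psi\in C_c^\infty(\Omega;\mathbb{C})$. Let $\Sigma$ be the set of Dirichlet eigenvalues, i.e. of those $k\in\mathbb{C}$ for which the problem with $\varphi=0$ has a nonzero solution. **Theorem 3.6.** The set $\Sigma$ is closed, and for all $k\in\mathbb{C}\setminus\Sigma$ and $\varphi\in H^{1/2}(\partial\Omega;\mathbb{C})$ the problem has a unique solution $u_k^{\varphi}\in H^1(\Omega;\mathbb{C})$. Let $\varphi_1,\varphi_2\in H^{1/2}(\partial\Omega;\mathbb{C})$, write $u_k^i=u_k^{\varphi_i}$, and let $i,j\in\{1,2\}$. Then the internal energies $$e^{ij}\colon k\mapsto q\,u_k^i\,u_k^j,\qquad E^{ij}\colon k\mapsto a\nabla u_k^i\cdot\nabla u_k^j$$ (bilinear products, without complex conjugation) are analytic maps from $\mathbb{C}\setminus\Sigma$ to $L^1(\Omega;\mathbb{C})$.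 **Corollary.** Let $k_l,k_\infty\in\mathbb{C}\setminus\Sigma$ with $k_l\to k_\infty$ and $k_l\ne k_\infty$ for every $l\in\mathbb{N}$. Then the values of $e^{ij}$ [resp. $E^{ij}$] at the $k_l$ determine $e^{ij}$ [resp. $E^{ij}$] on $\mathbb{C}\setminus\Sigma$, in the following two senses. 1. If $F\colon\mathbb{C}\setminus\Sigma\to L^1(\Omega;\mathbb{C})$ is analytic and $F(k_l)=e^{ij}(k_l)$ for all $l$, then $F=e^{ij}$ on $\mathbb{C}\setminus\Sigma$; and likewise for $E^{ij}$. 2. Let $(a',q')$ be a second pair of coefficients satisfying the above assumptions (possibly with other constants), with Dirichlet eigenvalues $\Sigma'$ and, for the same boundary data $\varphi_1,\varphi_2$, internal energies $e'^{ij},E'^{ij}$. Suppose in addition that $k_l,k_\infty\notin\Sigma'$. If $e'^{ij}(k_l)=e^{ij}(k_l)$ for all $l$, then $e'^{ij}=e^{ij}$ on $\mathbb{C}\setminus(\Sigma\cup\Sigma')$; and likewise for $E'^{ij}$ and $E^{ij}$. -/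

import Mathlib

open MeasureTheory Filter Topology TopologicalSpace
open scoped Distributions

namespace Helmholtz

/-- Lebesgue measure on the open set `Ω`. -/
noncomputable abbrev vol {d : ℕ} (Ω : Opens (EuclideanSpace ℝ (Fin d))) :
    Measure (EuclideanSpace ℝ (Fin d)) :=
  volume.restrict (Ω : Set (EuclideanSpace ℝ (Fin d)))

/-- The Hilbert space `L²(Ω; ℂ) × L²(Ω; ℂ)^d` that contains the graph of the weak gradient. -/
abbrev Pairs {d : ℕ} (Ω : Opens (EuclideanSpace ℝ (Fin d))) : Type :=
  WithLp 2 (Lp ℂ 2 (vol Ω) × PiLp 2 (fun _ : Fin d => Lp ℂ 2 (vol Ω)))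

/-- The `i`-th classical partial derivative of a test function. -/
noncomputable def pd {d : ℕ} {Ω : Opens (EuclideanSpace ℝ (Fin d))} (ψ : 𝓓(Ω, ℂ)) (i : Fin d)
    (x : EuclideanSpace ℝ (Fin d)) : ℂ :=
  fderiv ℝ ψ x (EuclideanSpace.single i 1)

theorem test_memLp {d : ℕ} {Ω : Opens (EuclideanSpace ℝ (Fin d))} (ψ : 𝓓(Ω, ℂ)) :
    MemLp (ψ : EuclideanSpace ℝ (Fin d) → ℂ) 2 (vol Ω) :=
  (ψ.continuous.memLp_of_hasCompactSupport ψ.hasCompactSupport).restrict _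

theorem pd_memLp {d : ℕ} {Ω : Opens (EuclideanSpace ℝ (Fin d))} (ψ : 𝓓(Ω, ℂ)) (i : Fin d) :
    MemLp (pd ψ i) 2 (vol Ω) := by
  have h1 : Continuous (pd ψ i) :=
    (ψ.contDiff.continuous_fderiv (by simp)).clm_apply continuous_const
  have h2 : HasCompactSupport (pd ψ i) := ψ.hasCompactSupport.fderiv_apply ℝ _
  exact (h1.memLp_of_hasCompactSupport h2).restrict _

theorem integrable_mul_test {d : ℕ} {Ω : Opens (EuclideanSpace ℝ (Fin d))}
    (f : Lp ℂ 2 (vol Ω)) (ψ : 𝓓(Ω, ℂ)) : Integrable (fun x => f x * ψ x) (vol Ω) :=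
  (Lp.memLp f).integrable_mul (test_memLp ψ)

theorem integrable_mul_pd {d : ℕ} {Ω : Opens (EuclideanSpace ℝ (Fin d))}
    (f : Lp ℂ 2 (vol Ω)) (ψ : 𝓓(Ω, ℂ)) (i : Fin d) :
    Integrable (fun x => f x * pd ψ i x) (vol Ω) :=
  (Lp.memLp f).integrable_mul (pd_memLp ψ i)

/-- `g` is the weak `i`-th partial derivative of `f` in `Ω`. -/
def IsWeakDeriv {d : ℕ} {Ω : Opens (EuclideanSpace ℝ (Fin d))} (i : Fin d)
    (f g : Lp ℂ 2 (vol Ω)) : Prop :=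
  ∀ ψ : 𝓓(Ω, ℂ), ∫ x, f x * pd ψ i x ∂(vol Ω) = -∫ x, g x * ψ x ∂(vol Ω)

theorem IsWeakDeriv.zero {d : ℕ} {Ω : Opens (EuclideanSpace ℝ (Fin d))} (i : Fin d) :
    IsWeakDeriv (Ω := Ω) i 0 0 := by
  intro ψ
  have h := Lp.coeFn_zero ℂ 2 (vol Ω)
  have e : ∀ χ : EuclideanSpace ℝ (Fin d) → ℂ,
      ∫ x, (0 : Lp ℂ 2 (vol Ω)) x * χ x ∂(vol Ω) = 0 := by
    intro χ
    refine integral_eq_zero_of_ae ?_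
    filter_upwards [h] with x hx
    rw [hx]; exact zero_mul _
  rw [e, e, neg_zero]

theorem IsWeakDeriv.add {d : ℕ} {Ω : Opens (EuclideanSpace ℝ (Fin d))} {i : Fin d}
    {f g f' g' : Lp ℂ 2 (vol Ω)} (h : IsWeakDeriv i f g) (h' : IsWeakDeriv i f' g') :
    IsWeakDeriv i (f + f') (g + g') := by
  intro ψ
  have e1 : ∫ x, (f + f') x * pd ψ i x ∂(vol Ω)
      = ∫ x, (f x * pd ψ i x + f' x * pd ψ i x) ∂(vol Ω) :=
    integral_congr_ae (by
      filter_upwards [Lp.coeFn_add f f'] with x hx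
      rw [hx, Pi.add_apply, add_mul])
  have e2 : ∫ x, (g + g') x * ψ x ∂(vol Ω) = ∫ x, (g x * ψ x + g' x * ψ x) ∂(vol Ω) :=
    integral_congr_ae (by
      filter_upwards [Lp.coeFn_add g g'] with x hx
      rw [hx, Pi.add_apply, add_mul])
  rw [e1, e2, integral_add (integrable_mul_pd f ψ i) (integrable_mul_pd f' ψ i),
    integral_add (integrable_mul_test g ψ) (integrable_mul_test g' ψ), h ψ, h' ψ]
  ring

theorem IsWeakDeriv.smul {d : ℕ} {Ω : Opens (EuclideanSpace ℝ (Fin d))} {i : Fin d}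
    {f g : Lp ℂ 2 (vol Ω)} (c : ℂ) (h : IsWeakDeriv i f g) :
    IsWeakDeriv i (c • f) (c • g) := by
  intro ψ
  have e1 : ∫ x, (c • f) x * pd ψ i x ∂(vol Ω) = ∫ x, c * (f x * pd ψ i x) ∂(vol Ω) :=
    integral_congr_ae (by
      filter_upwards [Lp.coeFn_smul c f] with x hx
      rw [hx, Pi.smul_apply, smul_eq_mul, mul_assoc])
  have e2 : ∫ x, (c • g) x * ψ x ∂(vol Ω) = ∫ x, c * (g x * ψ x) ∂(vol Ω) :=
    integral_congr_ae (by
      filter_upwards [Lp.coeFn_smul c g] with x hx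
      rw [hx, Pi.smul_apply, smul_eq_mul, mul_assoc])
  rw [e1, e2, integral_const_mul, integral_const_mul, h ψ]
  ring

/-- The Sobolev space `H¹(Ω; ℂ)`: pairs `(u, ∇u)` with `u` and its weak gradient `∇u` in `L²`.
It carries the norm `(‖u‖² + ‖∇u‖²)^(1/2)` and the corresponding inner product. -/
noncomputable def H1 {d : ℕ} (Ω : Opens (EuclideanSpace ℝ (Fin d))) : Submodule ℂ (Pairs Ω) where
  carrier := {p | ∀ i : Fin d, IsWeakDeriv i p.fst (p.snd i)}
  zero_mem' := fun i => IsWeakDeriv.zero i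
  add_mem' := fun hp hp' i => (hp i).add (hp' i)
  smul_mem' := fun c _ hp i => (hp i).smul c

/-- The function `u` itself, for `u` in `H¹(Ω; ℂ)`. -/
noncomputable def val {d : ℕ} {Ω : Opens (EuclideanSpace ℝ (Fin d))} (u : H1 Ω) :
    Lp ℂ 2 (vol Ω) :=
  (u : Pairs Ω).fst

/-- The `i`-th component of the weak gradient of `u` in `H¹(Ω; ℂ)`. -/
noncomputable def grad {d : ℕ} {Ω : Opens (EuclideanSpace ℝ (Fin d))} (u : H1 Ω) (i : Fin d) :
    Lp ℂ 2 (vol Ω) :=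
  (u : Pairs Ω).snd i

/-- The elements of `H¹(Ω; ℂ)` that are (almost everywhere equal to) test functions. -/
noncomputable def testSubmodule {d : ℕ} (Ω : Opens (EuclideanSpace ℝ (Fin d))) :
    Submodule ℂ (H1 Ω) where
  carrier := {u | ∃ ψ : 𝓓(Ω, ℂ), val u =ᵐ[vol Ω] ψ}
  zero_mem' := ⟨0, Lp.coeFn_zero ℂ 2 (vol Ω)⟩
  add_mem' := by
    rintro u v ⟨ψ, hψ⟩ ⟨χ, hχ⟩
    refine ⟨ψ + χ, ?_⟩
    filter_upwards [Lp.coeFn_add (val u) (val v), hψ, hχ] with x h1 h2 h3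
    change (val u + val v : Lp ℂ 2 (vol Ω)) x = ψ x + χ x
    rw [h1, Pi.add_apply, h2, h3]
  smul_mem' := by
    rintro c u ⟨ψ, hψ⟩
    refine ⟨c • ψ, ?_⟩
    filter_upwards [Lp.coeFn_smul c (val u), hψ] with x h1 h2
    change (c • val u : Lp ℂ 2 (vol Ω)) x = c • ψ x
    rw [h1, Pi.smul_apply, h2]

/-- The space `H¹₀(Ω; ℂ)`: the closure of the test functions in `H¹(Ω; ℂ)`. -/
noncomputable def H10 {d : ℕ} (Ω : Opens (EuclideanSpace ℝ (Fin d))) : Submodule ℂ (H1 Ω) :=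
  (testSubmodule Ω).topologicalClosure

/-- The trace space `H^{1/2}(∂Ω; ℂ)`, i.e. `H¹(Ω; ℂ)` modulo `H¹₀(Ω; ℂ)`: two functions have the
same boundary values when they differ by an element of `H¹₀`. -/
abbrev HHalf {d : ℕ} (Ω : Opens (EuclideanSpace ℝ (Fin d))) : Type := H1 Ω ⧸ H10 Ω

/-- The trace operator `γ : H¹(Ω; ℂ) → H^{1/2}(∂Ω; ℂ)`. -/
noncomputable def trace {d : ℕ} {Ω : Opens (EuclideanSpace ℝ (Fin d))} : H1 Ω →ₗ[ℂ] HHalf Ω :=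
  (H10 Ω).mkQ

/-- The coefficients of the equation in `Ω`: a real, symmetric, bounded and uniformly elliptic
tensor `a`, and a real function `q` bounded above and below by positive constants. -/
structure Coeff {d : ℕ} (Ω : Opens (EuclideanSpace ℝ (Fin d))) where
  a : EuclideanSpace ℝ (Fin d) → Matrix (Fin d) (Fin d) ℝ
  q : EuclideanSpace ℝ (Fin d) → ℝ
  a_meas : ∀ i j, AEStronglyMeasurable (fun x => a x i j) (vol Ω)
  a_symm : ∀ᵐ x ∂(vol Ω), (a x).IsSymm
  a_elliptic : ∃ lam Lam : ℝ, 0 < lam ∧ 0 < Lam ∧ ∀ᵐ x ∂(vol Ω), ∀ ξ : Fin d → ℝ,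
    lam * ∑ i, ξ i ^ 2 ≤ ∑ i, ∑ j, ξ i * a x i j * ξ j ∧
      ∑ i, ∑ j, ξ i * a x i j * ξ j ≤ Lam * ∑ i, ξ i ^ 2
  q_meas : AEStronglyMeasurable q (vol Ω)
  q_bounds : ∃ β₁ β₂ : ℝ, 0 < β₁ ∧ 0 < β₂ ∧ ∀ᵐ x ∂(vol Ω), β₁ ≤ q x ∧ q x ≤ β₂

namespace Coeff

variable {d : ℕ} {Ω : Opens (EuclideanSpace ℝ (Fin d))}

theorem a_bounded (M : Coeff Ω) :
    ∃ C : ℝ, ∀ᵐ x ∂(vol Ω), ∀ i j, ‖((M.a x i j : ℝ) : ℂ)‖ ≤ C := by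
  classical
  obtain ⟨lam, Lam, hlam, -, h⟩ := M.a_elliptic
  refine ⟨Lam, ?_⟩
  filter_upwards [h, M.a_symm] with x hx hs i j
  have hnn : ∀ ξ : Fin d → ℝ, 0 ≤ ∑ i, ∑ j, ξ i * M.a x i j * ξ j := fun ξ =>
    (mul_nonneg hlam.le (Finset.sum_nonneg fun i _ => sq_nonneg _)).trans (hx ξ).1
  have hdiag : ∀ i, M.a x i i ≤ Lam := by
    intro i
    have := (hx (Pi.single i 1)).2
    simpa [Pi.single_apply] using this
  have hsij : M.a x j i = M.a x i j := hs.apply i j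
  have hp := hnn (Pi.single i 1 + Pi.single j 1)
  have hm := hnn (Pi.single i 1 - Pi.single j 1)
  simp [Pi.single_apply, add_mul, mul_add, sub_mul, mul_sub, Finset.sum_add_distrib] at hp hm
  rw [Complex.norm_real, Real.norm_eq_abs, abs_le]
  have hi := hdiag i
  have hj := hdiag j
  constructor <;> linarith

theorem integrable_energy (M : Coeff Ω) (u v : H1 Ω) :
    Integrable (fun x => (M.q x : ℂ) * val u x * val v x) (vol Ω) := by
  obtain ⟨β₁, β₂, h1, -, h⟩ := M.q_bounds
  have hi : Integrable (fun x => val u x * val v x) (vol Ω) :=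
    (Lp.memLp (val u)).integrable_mul (Lp.memLp (val v))
  have := hi.bdd_mul (c := β₂) (f := fun x => (M.q x : ℂ))
    (Complex.continuous_ofReal.comp_aestronglyMeasurable M.q_meas) (by
      filter_upwards [h] with x hx
      rw [Complex.norm_real, Real.norm_eq_abs, abs_of_nonneg (h1.le.trans hx.1)]
      exact hx.2)
  simpa only [mul_assoc] using this

theorem integrable_gradEnergy (M : Coeff Ω) (u v : H1 Ω) :
    Integrable (fun x => ∑ i, ∑ j, (M.a x i j : ℂ) * grad u j x * grad v i x) (vol Ω) := by
  obtain ⟨C, h⟩ := M.a_bounded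
  refine integrable_finsetSum _ fun i _ => integrable_finsetSum _ fun j _ => ?_
  have hi : Integrable (fun x => grad u j x * grad v i x) (vol Ω) :=
    (Lp.memLp (grad u j)).integrable_mul (Lp.memLp (grad v i))
  have := hi.bdd_mul (c := C) (f := fun x => (M.a x i j : ℂ))
    (Complex.continuous_ofReal.comp_aestronglyMeasurable (M.a_meas i j)) (by
      filter_upwards [h] with x hx
      exact hx i j)
  simpa only [mul_assoc] using this

/-- `u` satisfies `-div (a ∇u) - k q u = 0` in `Ω` in the weak sense. -/
def IsWeakSol (M : Coeff Ω) (k : ℂ) (u : H1 Ω) : Prop :=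
  ∀ ψ : 𝓓(Ω, ℂ),
    ∫ x, (∑ i, ∑ j, (M.a x i j : ℂ) * grad u j x * pd ψ i x) ∂(vol Ω)
      - k * ∫ x, (M.q x : ℂ) * val u x * ψ x ∂(vol Ω) = 0

/-- The set `Σ` of the Dirichlet eigenvalues: those `k` for which the problem with zero boundary
values has a nonzero solution. -/
def spectrum (M : Coeff Ω) : Set ℂ :=
  {k | ∃ u : H1 Ω, u ∈ H10 Ω ∧ u ≠ 0 ∧ M.IsWeakSol k u}

/-- `u` solves `-div (a ∇u) - k q u = 0` in `Ω`, `u = φ` on `∂Ω`. -/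
def IsSolution (M : Coeff Ω) (k : ℂ) (φ : HHalf Ω) (u : H1 Ω) : Prop :=
  M.IsWeakSol k u ∧ trace u = φ

open Classical in
/-- The solution `u_k^φ` of the Dirichlet problem (a junk value when there is none). -/
noncomputable def sol (M : Coeff Ω) (k : ℂ) (φ : HHalf Ω) : H1 Ω :=
  if h : ∃ u, M.IsSolution k φ u then h.choose else 0

/-- The internal energy `q u_k^φ u_k^ψ`, as an element of `L¹(Ω; ℂ)`. -/
noncomputable def energy (M : Coeff Ω) (φ ψ : HHalf Ω) (k : ℂ) :
    Lp ℂ 1 (vol Ω) :=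
  (M.integrable_energy (M.sol k φ) (M.sol k ψ)).toL1 _

/-- The internal energy `a ∇u_k^φ · ∇u_k^ψ` (bilinear product, no complex conjugation), as an
element of `L¹(Ω; ℂ)`. -/
noncomputable def gradEnergy (M : Coeff Ω) (φ ψ : HHalf Ω) (k : ℂ) :
    Lp ℂ 1 (vol Ω) :=
  (M.integrable_gradEnergy (M.sol k φ) (M.sol k ψ)).toL1 _

end Coeff

end Helmholtz

/-!
The weak formulation is a problem in the Hilbert space `H¹`. The sesquilinear forms
`∫ a ∇u · conj ∇v` and `∫ q u conj v` are represented by bounded symmetric operators `A` and `Q`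
(`Coeff.formA`, `Coeff.formQ`), and since conjugation maps test functions to test functions, `u`
is a weak solution exactly when `(A - k Q) u` is orthogonal to `H¹₀` (`Coeff.isWeakSol_iff`).

Ellipticity of `a` and the lower bound on `q` make `A + Q` coercive, so it is invertible on `H¹₀`.
Because `Ω` is bounded, `H¹₀` embeds compactly into `L²` (`isCompactOperator_valL`), hence `Q` is
compact on `H¹₀` and the Fredholm alternative applies to `(A + Q)⁻¹ Q`: the compression of
`A - k Q` to `H¹₀` is invertible exactly when `k` is not a Dirichlet eigenvalue
(`isUnit_compress_iff`). Invertibility is an open condition and inversion is analytic, so the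
spectrum is closed and, off it, the solution with given boundary data is unique and depends
analytically on `k` (`exists_analyticOnNhd_solution`). The energies are continuous bilinear
expressions in the solutions with values in `L¹`, so they are analytic too.

For the determination statements the identity theorem needs a connected domain. Since `A` and `Q`
are symmetric, the eigenvalues are real, and by coercivity `-1` is not among them. A set of real
numbers that omits `-1` has a connected complement (`isPreconnected_compl_of_real`), and this also
covers the union of two spectra; neither discreteness nor countability of the spectrum is needed.

The compact embedding is proved by approximation with operators of finite rank. Replacing a
function by its means over the cells of a cubical grid of side `h` costs at most a constant times
`h ‖∇u‖` in `L²`: on each cell the deviation from the mean is controlled by the translation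
differences `u(x + z) - u(x)` with `|zᵢ| < h`, and these are of order `h ‖∇u‖`. Since
elements of `H¹₀` extend by zero, no regularity of the boundary enters.
-/

namespace Helmholtz

open scoped InnerProductSpace ComplexConjugate ENNReal

/-! ### Compact symmetric pencils in a Hilbert space -/

section Pencil

variable {V X : Type*} [NormedAddCommGroup V] [InnerProductSpace ℂ V]
  [NormedAddCommGroup X] [InnerProductSpace ℂ X]

/-- The eigenvalues `k` of the generalized problem `A u = k Q u`, for eigenvectors and test vectors
in the space `V`, which `J` maps into the space `X` where `A` and `Q` act. -/
def pencilSpectrum (J : V →L[ℂ] X) (A Q : X →L[ℂ] X) : Set ℂ :=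
  {k | ∃ u : V, u ≠ 0 ∧ ∀ v : V, ⟪J v, (A - k • Q) (J u)⟫_ℂ = 0}

theorem eq_of_notMem_pencilSpectrum {J : V →L[ℂ] X} {A Q : X →L[ℂ] X} {k : ℂ}
    (hk : k ∉ pencilSpectrum J A Q) {u w : X} {e : V} (huw : u - w = J e)
    (hu : ∀ v, ⟪J v, (A - k • Q) u⟫_ℂ = 0) (hw : ∀ v, ⟪J v, (A - k • Q) w⟫_ℂ = 0) : u = w := by
  by_contra h
  refine hk ⟨e, fun h0 => h ?_, fun v => ?_⟩
  · rwa [h0, map_zero, sub_eq_zero] at huw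
  · rw [← huw, map_sub, inner_sub_right, hu, hw, sub_zero]

section Coercive

variable {J : V →L[ℂ] X} {A Q : X →L[ℂ] X} {c : ℝ}

theorem pencilSpectrum_subset_real (hc : 0 < c)
    (hAQ : ∀ u : V, c * ‖u‖ ^ 2 ≤ ‖⟪J u, (A + Q) (J u)⟫_ℂ‖)
    (hA : (A : X →ₗ[ℂ] X).IsSymmetric) (hQ : (Q : X →ₗ[ℂ] X).IsSymmetric) {k : ℂ}
    (hk : k ∈ pencilSpectrum J A Q) : k.im = 0 := by
  obtain ⟨u, hu0, h⟩ := hk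
  have h1 : ⟪J u, A (J u)⟫_ℂ = k * ⟪J u, Q (J u)⟫_ℂ := by
    simpa [inner_sub_right, inner_smul_right, sub_eq_zero] using h u
  have hAr : (⟪J u, A (J u)⟫_ℂ).im = 0 := hA.im_inner_self_apply (J u)
  have hQr : (⟪J u, Q (J u)⟫_ℂ).im = 0 := hQ.im_inner_self_apply (J u)
  -- If the form of `Q` vanished at `u`, then so would that of `A`, against coercivity.
  have hQ0 : (⟪J u, Q (J u)⟫_ℂ).re ≠ 0 := by
    intro h0
    have hQz : ⟪J u, Q (J u)⟫_ℂ = 0 := Complex.ext h0 hQr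
    have := hAQ u
    rw [add_apply, inner_add_right, h1, hQz, mul_zero, add_zero, norm_zero] at this
    have : 0 < c * ‖u‖ ^ 2 := by positivity
    linarith
  have := congrArg Complex.im h1
  rw [hAr, Complex.mul_im, hQr, mul_zero, zero_add] at this
  exact (mul_eq_zero.1 this.symm).resolve_right hQ0

theorem neg_one_notMem_pencilSpectrum (hc : 0 < c)
    (hAQ : ∀ u : V, c * ‖u‖ ^ 2 ≤ ‖⟪J u, (A + Q) (J u)⟫_ℂ‖) : -1 ∉ pencilSpectrum J A Q := by
  rintro ⟨u, hu0, h⟩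
  have h1 := hAQ u
  have h2 := h u
  rw [neg_one_smul, sub_neg_eq_add] at h2
  rw [h2, norm_zero] at h1
  have : 0 < c * ‖u‖ ^ 2 := by positivity
  linarith

end Coercive

variable [CompleteSpace V] [CompleteSpace X]

/-- The operator on `V` that represents the sesquilinear form of `T` pulled back along `J`. -/
noncomputable def compress (J : V →L[ℂ] X) (T : X →L[ℂ] X) : V →L[ℂ] V :=
  (ContinuousLinearMap.adjoint J ∘L T) ∘L J

variable {J : V →L[ℂ] X} {A Q : X →L[ℂ] X} {c : ℝ}

theorem inner_compress (T : X →L[ℂ] X) (v u : V) :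
    ⟪v, compress J T u⟫_ℂ = ⟪J v, T (J u)⟫_ℂ := by
  simp [compress, ContinuousLinearMap.adjoint_inner_right]

theorem adjoint_eq_zero_iff (w : X) :
    ContinuousLinearMap.adjoint J w = 0 ↔ ∀ v, ⟪J v, w⟫_ℂ = 0 := by
  simp_rw [← ContinuousLinearMap.adjoint_inner_right]
  exact ⟨fun h v => by rw [h, inner_zero_right],
    fun h => ext_inner_left ℂ fun v => by rw [h, inner_zero_right]⟩

theorem mem_pencilSpectrum_iff {k : ℂ} :
    k ∈ pencilSpectrum J A Q ↔ ∃ u : V, u ≠ 0 ∧ compress J (A - k • Q) u = 0 := by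
  simp_rw [pencilSpectrum, Set.mem_ofPred_eq, ← adjoint_eq_zero_iff]
  rfl

theorem compress_sub_smul (k : ℂ) :
    compress J (A - k • Q) = compress J (A + Q) - (k + 1) • compress J Q := by
  ext u
  simp only [compress, ContinuousLinearMap.comp_apply, sub_apply, add_apply,
    smul_apply, map_sub, map_add, map_smul, add_smul, one_smul]
  abel

/-- Coercivity makes the form of `A + Q` on `V` invertible. -/
theorem isUnit_compress_add (hc : 0 < c)
    (hAQ : ∀ u : V, c * ‖u‖ ^ 2 ≤ ‖⟪J u, (A + Q) (J u)⟫_ℂ‖) : IsUnit (compress J (A + Q)) := by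
  refine ContinuousLinearMap.isUnit_of_forall_le_norm_inner_map _ (c := ⟨c, hc.le⟩) hc fun u => ?_
  rw [norm_inner_symm, inner_compress, mul_comm]
  exact hAQ u

/-- Off the eigenvalues the pencil is invertible on `V`: this is the Fredholm alternative for the
compact operator `(A + Q)⁻¹ Q`. -/
theorem isUnit_compress_iff (hc : 0 < c)
    (hAQ : ∀ u : V, c * ‖u‖ ^ 2 ≤ ‖⟪J u, (A + Q) (J u)⟫_ℂ‖)
    (hQ : IsCompactOperator (Q ∘L J)) {k : ℂ} :
    IsUnit (compress J (A - k • Q)) ↔ k ∉ pencilSpectrum J A Q := by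
  constructor
  · rintro h hk
    obtain ⟨u, hu0, hu⟩ := mem_pencilSpectrum_iff.1 hk
    exact hu0 ((ContinuousLinearMap.isUnit_iff_bijective.1 h).1 (by rw [hu, map_zero]))
  · intro hk
    obtain ⟨S, hS⟩ := isUnit_compress_add hc hAQ
    -- At `k = -1` the pencil is `A + Q` itself.
    by_cases hk1 : k + 1 = 0
    · rw [compress_sub_smul, hk1, zero_smul, sub_zero, ← hS]
      exact S.isUnit
    · set C : V →L[ℂ] V := (↑S⁻¹ : V →L[ℂ] V) ∘L compress J Q with hC
      have hSC : (S : V →L[ℂ] V) * C = compress J Q := by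
        change (S : V →L[ℂ] V) * ((↑S⁻¹ : V →L[ℂ] V) * compress J Q) = _
        rw [← mul_assoc, S.mul_inv, one_mul]
      have hCc : IsCompactOperator C :=
        hQ.clm_comp ((↑S⁻¹ : V →L[ℂ] V) ∘L ContinuousLinearMap.adjoint J)
      have hfac : compress J (A - k • Q)
          = (k + 1) • ((S : V →L[ℂ] V) * (algebraMap ℂ (V →L[ℂ] V) (k + 1)⁻¹ - C)) := by
        rw [mul_sub, hSC, compress_sub_smul, ← hS, smul_sub, Algebra.algebraMap_eq_smul_one,
          mul_smul_comm, mul_one, smul_smul, mul_inv_cancel₀ hk1, one_smul]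
      rcases hCc.hasEigenvalue_or_mem_resolventSet (inv_ne_zero hk1) with h | h
      · obtain ⟨u, hu⟩ := h.exists_hasEigenvector
        refine absurd (mem_pencilSpectrum_iff.2 ⟨u, hu.2, ?_⟩) hk
        have hCu : C u = (k + 1)⁻¹ • u := hu.apply_eq_smul
        rw [hfac]
        simp [hCu, Algebra.algebraMap_eq_smul_one]
      · rw [hfac]
        have hunit : IsUnit (algebraMap ℂ (V →L[ℂ] V) (k + 1)⁻¹ - C) := h
        exact (S.isUnit.mul hunit).smul (Units.mk0 _ hk1)

theorem isClosed_pencilSpectrum (hc : 0 < c)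
    (hAQ : ∀ u : V, c * ‖u‖ ^ 2 ≤ ‖⟪J u, (A + Q) (J u)⟫_ℂ‖)
    (hQ : IsCompactOperator (Q ∘L J)) : IsClosed (pencilSpectrum J A Q) := by
  rw [← isOpen_compl_iff]
  have h1 : (pencilSpectrum J A Q)ᶜ
      = (fun k : ℂ => compress J (A - k • Q)) ⁻¹' {T | IsUnit T} :=
    Set.ext fun k => (isUnit_compress_iff hc hAQ hQ).symm
  have h2 : Continuous fun k : ℂ => compress J (A - k • Q) := by
    simp_rw [compress_sub_smul]
    fun_prop
  rw [h1]
  exact Units.isOpen.preimage h2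

/-- The problem with data `Φ` is solved by `Φ` minus the inverse of the pencil applied to the
residual of `Φ`, and inversion is analytic. -/
theorem exists_analyticOnNhd_solution (hc : 0 < c)
    (hAQ : ∀ u : V, c * ‖u‖ ^ 2 ≤ ‖⟪J u, (A + Q) (J u)⟫_ℂ‖)
    (hQ : IsCompactOperator (Q ∘L J)) (Φ : X) :
    ∃ s : ℂ → X, AnalyticOnNhd ℂ s (pencilSpectrum J A Q)ᶜ ∧
      ∀ k ∉ pencilSpectrum J A Q, (∃ e, s k = Φ - J e) ∧
        ∀ v, ⟪J v, (A - k • Q) (s k)⟫_ℂ = 0 := by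
  set ρ : X →L[ℂ] V := ContinuousLinearMap.adjoint J with hρ
  refine ⟨fun k => Φ - J (Ring.inverse (compress J (A - k • Q)) (ρ ((A - k • Q) Φ))),
    fun k hk => ?_, fun k hk => ?_⟩
  · have hunit := (isUnit_compress_iff hc hAQ hQ).2 hk
    have h1 : AnalyticAt ℂ (fun k : ℂ => compress J (A - k • Q)) k := by
      simp_rw [compress_sub_smul]
      exact analyticAt_const.sub ((analyticAt_id.add analyticAt_const).smul analyticAt_const)
    have h2 : AnalyticAt ℂ (fun k : ℂ => Ring.inverse (compress J (A - k • Q))) k :=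
      AnalyticAt.fun_comp (g := Ring.inverse)
        (analyticOnNhd_inverse (𝕜 := ℂ) (compress J (A - k • Q)) hunit) h1
    have h3 : AnalyticAt ℂ (fun k : ℂ => ρ ((A - k • Q) Φ)) k := by
      simp only [sub_apply, smul_apply, map_sub, map_smul]
      exact analyticAt_const.sub (analyticAt_id.smul analyticAt_const)
    exact analyticAt_const.sub ((J.analyticAt _).fun_comp (AnalyticAt.comp₂
      ((ContinuousLinearMap.id ℂ (V →L[ℂ] V)).analyticAt_bilinear _) h2 h3))
  · obtain ⟨T, hT⟩ := (isUnit_compress_iff hc hAQ hQ).2 hk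
    refine ⟨⟨_, rfl⟩, (adjoint_eq_zero_iff _).1 ?_⟩
    rw [map_sub, map_sub, ← hT, Ring.inverse_unit, sub_eq_zero, ← hρ]
    have h : compress J (A - k • Q) ((↑T⁻¹ : V →L[ℂ] V) (ρ ((A - k • Q) Φ)))
        = ρ ((A - k • Q) Φ) := by
      rw [← hT, ← mul_apply_eq_comp, T.mul_inv, one_apply_eq_self]
    exact h.symm

end Pencil

/-- A set of real numbers that omits `-1` does not disconnect the complex plane: a non-real point
is joined to `-1` by a segment, and a real point of the complement to a non-real one by a vertical
segment. -/
theorem isPreconnected_compl_of_real {S : Set ℂ} (hS : ∀ z ∈ S, z.im = 0) (h1 : -1 ∉ S) :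
    IsPreconnected Sᶜ := by
  have key : ∀ z w : ℂ, z ∉ S → z.im = 0 → w.im ≠ 0 → segment ℝ z w ⊆ Sᶜ := by
    rintro z w hz hz0 hw _ ⟨a, b, -, -, hab, rfl⟩ hmem
    have him := hS _ hmem
    have hb : b = 0 := by simpa [hz0, hw] using him
    have ha : a = 1 := by linarith
    exact hz (by simpa [ha, hb] using hmem)
  refine isPreconnected_of_forall (-1) fun z hz => ?_
  by_cases hz0 : z.im = 0
  · have hw : (z + Complex.I).im ≠ 0 := by simp [hz0]
    refine ⟨segment ℝ (-1) (z + Complex.I) ∪ segment ℝ z (z + Complex.I),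
      Set.union_subset (key _ _ h1 (by simp) hw) (key _ _ hz hz0 hw),
      Or.inl (left_mem_segment ..), Or.inr (left_mem_segment ..), ?_⟩
    exact (convex_segment _ _).isPreconnected.union _ (right_mem_segment ..)
      (right_mem_segment ..) (convex_segment _ _).isPreconnected
  · exact ⟨segment ℝ (-1) z, key _ _ h1 (by simp) hz0, left_mem_segment ..,
      right_mem_segment .., (convex_segment _ _).isPreconnected⟩

/-! ### The Sobolev space as a Hilbert space -/

section Multiplication

variable {α : Type*} [MeasurableSpace α] {μ : Measure α}

/-- Multiplication of `L²` functions by a function `m`, which is the zero operator unless `m` is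
measurable and essentially bounded. -/
noncomputable def mulL (μ : Measure α) (m : α → ℝ) : Lp ℂ 2 μ →L[ℂ] Lp ℂ 2 μ :=
  open Classical in
  if h : MemLp (fun x => (m x : ℂ)) ⊤ μ then
    (ContinuousLinearMap.mul ℂ ℂ).holderL μ ⊤ 2 2 h.toLp
  else 0

theorem coeFn_mulL {m : α → ℝ} (h : MemLp (fun x => (m x : ℂ)) ⊤ μ) (f : Lp ℂ 2 μ) :
    mulL μ m f =ᵐ[μ] fun x => (m x : ℂ) * f x := by
  rw [mulL, dif_pos h]
  filter_upwards [(ContinuousLinearMap.mul ℂ ℂ).coeFn_holder (r := 2) h.toLp f,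
    h.coeFn_toLp] with x h1 h2
  rw [ContinuousLinearMap.holderL_apply_apply, h1, ContinuousLinearMap.mul_apply', h2]

theorem inner_mulL {m : α → ℝ} (h : MemLp (fun x => (m x : ℂ)) ⊤ μ) (f g : Lp ℂ 2 μ) :
    ⟪g, mulL μ m f⟫_ℂ = ∫ x, (m x : ℂ) * f x * conj (g x) ∂μ := by
  rw [L2.inner_def]
  refine integral_congr_ae ?_
  filter_upwards [coeFn_mulL h f] with x hx
  rw [hx, RCLike.inner_apply]

theorem integrable_inner_mulL {m : α → ℝ} (h : MemLp (fun x => (m x : ℂ)) ⊤ μ) (f g : Lp ℂ 2 μ) :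
    Integrable (fun x => (m x : ℂ) * f x * conj (g x)) μ := by
  refine (L2.integrable_inner (𝕜 := ℂ) g (mulL μ m f)).congr ?_
  filter_upwards [coeFn_mulL h f] with x hx
  rw [hx, RCLike.inner_apply]

/-- The product of two `L²` functions, as a continuous bilinear map into `L¹`. -/
noncomputable def mulL2L1 (μ : Measure α) : Lp ℂ 2 μ →L[ℂ] Lp ℂ 2 μ →L[ℂ] Lp ℂ 1 μ :=
  (ContinuousLinearMap.mul ℂ ℂ).holderL μ 2 2 1

theorem coeFn_mulL2L1 (f g : Lp ℂ 2 μ) : mulL2L1 μ f g =ᵐ[μ] fun x => f x * g x :=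
  (ContinuousLinearMap.mul ℂ ℂ).coeFn_holder f g

theorem continuous_integral_mul {χ : α → ℂ} (hχ : MemLp χ 2 μ) :
    Continuous fun f : Lp ℂ 2 μ => ∫ x, f x * χ x ∂μ := by
  have h : (fun f : Lp ℂ 2 μ => ∫ x, f x * χ x ∂μ)
      = fun f => (ContinuousLinearMap.mul ℂ ℂ).lpPairing μ 2 2 f hχ.toLp := by
    ext f
    rw [ContinuousLinearMap.lpPairing_eq_integral]
    refine integral_congr_ae ?_
    filter_upwards [hχ.coeFn_toLp] with x hx
    rw [ContinuousLinearMap.mul_apply', hx]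
  rw [h]
  fun_prop

end Multiplication

variable {d : ℕ} {Ω : Opens (EuclideanSpace ℝ (Fin d))}

theorem isClosed_H1 : IsClosed (H1 Ω : Set (Pairs Ω)) := by
  have h : (H1 Ω : Set (Pairs Ω)) = ⋂ (i : Fin d) (ψ : 𝓓(Ω, ℂ)), {p |
      ∫ x, p.fst x * pd ψ i x ∂(vol Ω) = -∫ x, p.snd i x * ψ x ∂(vol Ω)} := by
    ext p
    simp only [Set.mem_iInter]
    rfl
  rw [h]
  refine isClosed_iInter fun i => isClosed_iInter fun ψ => isClosed_eq ?_ ?_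
  · exact (continuous_integral_mul (pd_memLp ψ i)).comp
      (WithLp.fstL 2 ℂ (Lp ℂ 2 (vol Ω)) (PiLp 2 fun _ : Fin d => Lp ℂ 2 (vol Ω))).continuous
  · exact ((continuous_integral_mul (test_memLp ψ)).comp
      ((PiLp.proj 2 (𝕜 := ℂ) (fun _ : Fin d => Lp ℂ 2 (vol Ω)) i).continuous.comp
        (WithLp.sndL 2 ℂ (Lp ℂ 2 (vol Ω)) (PiLp 2 fun _ : Fin d => Lp ℂ 2 (vol Ω))).continuous)).neg

instance : CompleteSpace (H1 Ω) :=
  isClosed_H1.completeSpace_coe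

instance : CompleteSpace (H10 Ω) :=
  (testSubmodule Ω).isClosed_topologicalClosure.completeSpace_coe

/-- The embedding of `H¹` into `L²`. -/
noncomputable def valL (Ω : Opens (EuclideanSpace ℝ (Fin d))) : H1 Ω →L[ℂ] Lp ℂ 2 (vol Ω) :=
  WithLp.fstL 2 ℂ (Lp ℂ 2 (vol Ω)) (PiLp 2 fun _ : Fin d => Lp ℂ 2 (vol Ω)) ∘L (H1 Ω).subtypeL

/-- The `i`-th weak derivative, as a continuous map from `H¹` to `L²`. -/
noncomputable def gradL (Ω : Opens (EuclideanSpace ℝ (Fin d))) (i : Fin d) :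
    H1 Ω →L[ℂ] Lp ℂ 2 (vol Ω) :=
  PiLp.proj 2 (𝕜 := ℂ) (fun _ : Fin d => Lp ℂ 2 (vol Ω)) i ∘L
    (WithLp.sndL 2 ℂ (Lp ℂ 2 (vol Ω)) (PiLp 2 fun _ : Fin d => Lp ℂ 2 (vol Ω)) ∘L (H1 Ω).subtypeL)

theorem valL_apply (u : H1 Ω) : valL Ω u = val u := rfl

theorem gradL_apply (i : Fin d) (u : H1 Ω) : gradL Ω i u = grad u i := rfl

theorem norm_sq_H1 (u : H1 Ω) : ‖u‖ ^ 2 = ‖val u‖ ^ 2 + ∑ i, ‖grad u i‖ ^ 2 := by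
  have h := WithLp.prod_norm_sq_eq_of_L2 (u : Pairs Ω)
  rw [PiLp.norm_sq_eq_of_L2] at h
  exact h

/-! ### Test functions -/

/-- The complex conjugate of a test function. -/
noncomputable def conjTest (ψ : 𝓓(Ω, ℂ)) : 𝓓(Ω, ℂ) where
  toFun x := conj (ψ x)
  contDiff' := Complex.conjCLE.contDiff.comp ψ.contDiff
  hasCompactSupport' := ψ.hasCompactSupport.comp_left (map_zero _)
  tsupport_subset' := (tsupport_comp_subset (map_zero _) _).trans ψ.tsupport_subset

theorem conjTest_apply (ψ : 𝓓(Ω, ℂ)) (x : EuclideanSpace ℝ (Fin d)) :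
    conjTest ψ x = conj (ψ x) := rfl

theorem differentiable_test (ψ : 𝓓(Ω, ℂ)) : Differentiable ℝ ψ :=
  ψ.contDiff.differentiable (by simp)

theorem pd_conjTest (ψ : 𝓓(Ω, ℂ)) (i : Fin d) (x : EuclideanSpace ℝ (Fin d)) :
    pd (conjTest ψ) i x = conj (pd ψ i x) := by
  have h : HasFDerivAt (conjTest ψ) ((Complex.conjCLE : ℂ →L[ℝ] ℂ) ∘L fderiv ℝ ψ x) x :=
    Complex.conjCLE.hasFDerivAt.comp x (differentiable_test ψ x).hasFDerivAt
  rw [pd, h.fderiv]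
  rfl

theorem test_eq_zero (ψ : 𝓓(Ω, ℂ)) {x : EuclideanSpace ℝ (Fin d)} (hx : x ∉ Ω) : ψ x = 0 :=
  image_eq_zero_of_notMem_tsupport fun h => hx (ψ.tsupport_subset h)

theorem pd_eq_zero (ψ : 𝓓(Ω, ℂ)) (i : Fin d) {x : EuclideanSpace ℝ (Fin d)} (hx : x ∉ Ω) :
    pd ψ i x = 0 := by
  have : fderiv ℝ ψ x = 0 := image_eq_zero_of_notMem_tsupport fun h =>
    hx (ψ.tsupport_subset (tsupport_fderiv_subset ℝ h))
  rw [pd, this]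
  rfl

theorem continuous_pd (ψ : 𝓓(Ω, ℂ)) (i : Fin d) : Continuous (pd ψ i) :=
  (ψ.contDiff.continuous_fderiv (by simp)).clm_apply continuous_const

/-- The classical and the weak derivative of a test function agree. -/
theorem isWeakDeriv_test (ψ : 𝓓(Ω, ℂ)) (i : Fin d) :
    IsWeakDeriv i ((test_memLp ψ).toLp) ((pd_memLp ψ i).toLp) := by
  intro χ
  have hint : ∀ f g : EuclideanSpace ℝ (Fin d) → ℂ, Continuous f → Continuous g →
      HasCompactSupport g → Integrable (fun x => f x * g x) := fun f g hf hg hgc =>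
    (hf.mul hg).integrable_of_hasCompactSupport hgc.mul_left
  have hpc : ∀ χ : 𝓓(Ω, ℂ), HasCompactSupport (pd χ i) := fun χ =>
    χ.hasCompactSupport.fderiv_apply ℝ _
  have key := integral_mul_fderiv_eq_neg_fderiv_mul_of_integrable (𝕜 := ℂ)
    (μ := (volume : Measure (EuclideanSpace ℝ (Fin d)))) (f := ψ) (g := χ)
    (v := EuclideanSpace.single i 1)
    (hint _ _ (continuous_pd ψ i) χ.continuous χ.hasCompactSupport)
    (hint _ _ ψ.continuous (continuous_pd χ i) (hpc χ))
    (hint _ _ ψ.continuous χ.continuous χ.hasCompactSupport)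
    (fun x _ => differentiable_test ψ x) (fun x _ => differentiable_test χ x)
  have e1 : ∫ x, (test_memLp ψ).toLp ψ x * pd χ i x ∂(vol Ω) = ∫ x, ψ x * pd χ i x := by
    have hs : ∫ x, ψ x * pd χ i x ∂(vol Ω) = ∫ x, ψ x * pd χ i x :=
      setIntegral_eq_integral_of_forall_compl_eq_zero fun x hx => by rw [test_eq_zero ψ hx, zero_mul]
    rw [← hs]
    refine integral_congr_ae ?_
    filter_upwards [(test_memLp ψ).coeFn_toLp] with x hx
    rw [hx]
  have e2 : ∫ x, (pd_memLp ψ i).toLp (pd ψ i) x * χ x ∂(vol Ω) = ∫ x, pd ψ i x * χ x := by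
    have hs : ∫ x, pd ψ i x * χ x ∂(vol Ω) = ∫ x, pd ψ i x * χ x :=
      setIntegral_eq_integral_of_forall_compl_eq_zero fun x hx => by rw [test_eq_zero χ hx, mul_zero]
    rw [← hs]
    refine integral_congr_ae ?_
    filter_upwards [(pd_memLp ψ i).coeFn_toLp] with x hx
    rw [hx]
  rw [e1, e2]
  exact key

/-- A test function with its classical gradient, as an element of `H¹`. -/
noncomputable def testH1 (ψ : 𝓓(Ω, ℂ)) : H1 Ω :=
  ⟨WithLp.toLp 2 ((test_memLp ψ).toLp, WithLp.toLp 2 fun i => (pd_memLp ψ i).toLp),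
    fun i => isWeakDeriv_test ψ i⟩

theorem coeFn_val_testH1 (ψ : 𝓓(Ω, ℂ)) : val (testH1 ψ) =ᵐ[vol Ω] ψ :=
  (test_memLp ψ).coeFn_toLp

theorem coeFn_grad_testH1 (ψ : 𝓓(Ω, ℂ)) (i : Fin d) : grad (testH1 ψ) i =ᵐ[vol Ω] pd ψ i :=
  (pd_memLp ψ i).coeFn_toLp

theorem testH1_mem (ψ : 𝓓(Ω, ℂ)) : testH1 ψ ∈ testSubmodule Ω :=
  ⟨ψ, coeFn_val_testH1 ψ⟩

/-- An `L²` function that is orthogonal to all test functions vanishes. -/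
theorem eq_zero_of_forall_integral_mul_test {g : Lp ℂ 2 (vol Ω)}
    (h : ∀ ψ : 𝓓(Ω, ℂ), ∫ x, g x * ψ x ∂(vol Ω) = 0) : g = 0 := by
  have hloc : LocallyIntegrableOn g (Ω : Set (EuclideanSpace ℝ (Fin d))) := by
    refine (locallyIntegrableOn_of_locallyIntegrable_restrict ?_)
    exact (Lp.memLp g).locallyIntegrable (by norm_num)
  have h0 := Ω.isOpen.ae_eq_zero_of_integral_contDiff_smul_eq_zero hloc fun χ h1 h2 h3 => by
    let ψ : 𝓓(Ω, ℂ) :=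
      { toFun := fun x => (χ x : ℂ)
        contDiff' := Complex.ofRealCLM.contDiff.comp h1
        hasCompactSupport' := h2.comp_left Complex.ofReal_zero
        tsupport_subset' := (tsupport_comp_subset Complex.ofReal_zero _).trans h3 }
    rw [← h ψ, ← setIntegral_eq_integral_of_forall_compl_eq_zero (s := (Ω : Set _))]
    · refine integral_congr_ae (Eventually.of_forall fun x => ?_)
      change χ x • g x = g x * (χ x : ℂ)
      rw [Complex.real_smul, mul_comm]
    · intro x hx
      rw [image_eq_zero_of_notMem_tsupport fun hx' => hx (h3 hx'), zero_smul]
  refine Lp.ext ?_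
  filter_upwards [(ae_restrict_iff' Ω.isOpen.measurableSet).2 h0,
    Lp.coeFn_zero ℂ 2 (vol Ω)] with x h1 h2
  rw [h1, h2]
  rfl

theorem IsWeakDeriv.unique {i : Fin d} {f g g' : Lp ℂ 2 (vol Ω)} (h : IsWeakDeriv i f g)
    (h' : IsWeakDeriv i f g') : g = g' := by
  rw [← sub_eq_zero]
  -- `g - g'` is a weak derivative of zero.
  have h0 := h.add (h'.smul (-1))
  refine eq_zero_of_forall_integral_mul_test fun ψ => ?_
  have e := h0 ψ
  rw [neg_one_smul, neg_one_smul, ← sub_eq_add_neg, ← sub_eq_add_neg, sub_self] at e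
  rw [← neg_inj, ← e, neg_zero]
  refine integral_eq_zero_of_ae ?_
  filter_upwards [Lp.coeFn_zero ℂ 2 (vol Ω)] with x hx
  rw [hx]
  exact zero_mul _

/-- The elements of `testSubmodule` are specified by their values only; their gradients are then the
classical ones. -/
theorem exists_eq_testH1 {u : H1 Ω} (hu : u ∈ testSubmodule Ω) : ∃ ψ : 𝓓(Ω, ℂ), u = testH1 ψ := by
  obtain ⟨ψ, hψ⟩ := hu
  have h1 : val u = val (testH1 ψ) := Lp.ext (hψ.trans (coeFn_val_testH1 ψ).symm)
  refine ⟨ψ, Subtype.ext (WithLp.ofLp_injective 2 (Prod.ext h1 (PiLp.ext fun i => ?_)))⟩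
  refine (u.2 i).unique ?_
  change IsWeakDeriv i (val u) _
  rw [h1]
  exact (testH1 ψ).2 i

theorem testH1_mem_H10 (ψ : 𝓓(Ω, ℂ)) : testH1 ψ ∈ H10 Ω :=
  (testSubmodule Ω).le_topologicalClosure (testH1_mem ψ)

/-- A closed property that holds for the test functions holds on `H¹₀`. -/
theorem H10_induction {P : H1 Ω → Prop} (hP : IsClosed {u | P u}) (h : ∀ ψ : 𝓓(Ω, ℂ), P (testH1 ψ))
    {u : H1 Ω} (hu : u ∈ H10 Ω) : P u := by
  refine closure_minimal (s := (testSubmodule Ω : Set (H1 Ω))) (fun v hv => ?_) hP hu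
  obtain ⟨ψ, rfl⟩ := exists_eq_testH1 hv
  exact h ψ

/-! ### Square means -/

theorem enorm_sq_Lp_two {α : Type*} [MeasurableSpace α] {μ : Measure α} (f : Lp ℂ 2 μ) :
    ‖f‖ₑ ^ 2 = ∫⁻ x, ‖f x‖ₑ ^ 2 ∂μ := by
  have := eLpNorm_nnreal_pow_eq_lintegral (μ := μ) (f := f) (p := 2) (by norm_num)
  simpa [Lp.enorm_def] using this

theorem lintegral_sq_le {α : Type*} [MeasurableSpace α] (μ : Measure α) {f : α → ℝ≥0∞}
    (hf : AEMeasurable f μ) : (∫⁻ x, f x ∂μ) ^ 2 ≤ μ Set.univ * ∫⁻ x, f x ^ 2 ∂μ := by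
  have h := ENNReal.lintegral_mul_le_Lp_mul_Lq μ Real.HolderConjugate.two_two hf
    (aemeasurable_const (b := (1 : ℝ≥0∞)))
  have h2 := pow_le_pow_left₀ (zero_le) h 2
  rw [mul_pow, ← ENNReal.rpow_natCast, ← ENNReal.rpow_natCast, ← ENNReal.rpow_natCast,
    ← ENNReal.rpow_mul, ← ENNReal.rpow_mul] at h2
  simp at h2
  rw [mul_comm]
  exact h2

/-- The squared distance from `c` to the mean of `f` is at most the mean squared distance. -/
theorem enorm_sub_average_sq_le {α : Type*} [MeasurableSpace α] {μ : Measure α} [IsFiniteMeasure μ]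
    [NeZero μ] {f : α → ℂ} (hf : Integrable f μ) (c : ℂ) :
    ‖c - (μ.real Set.univ : ℂ)⁻¹ * ∫ y, f y ∂μ‖ₑ ^ 2
      ≤ (μ Set.univ)⁻¹ * ∫⁻ y, ‖f y - c‖ₑ ^ 2 ∂μ := by
  have hm0 : μ Set.univ ≠ 0 := Measure.measure_univ_ne_zero.2 (NeZero.ne μ)
  have hmt : μ Set.univ ≠ ∞ := measure_ne_top _ _
  have hr : (μ.real Set.univ : ℂ) ≠ 0 :=
    Complex.ofReal_ne_zero.2 (ENNReal.toReal_ne_zero.2 ⟨hm0, hmt⟩)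
  have e1 : c - (μ.real Set.univ : ℂ)⁻¹ * ∫ y, f y ∂μ
      = -((μ.real Set.univ : ℂ)⁻¹ * ∫ y, (f y - c) ∂μ) := by
    rw [integral_sub hf (integrable_const c), integral_const, Complex.real_smul]
    field_simp
    ring
  have e2 : ‖(μ.real Set.univ : ℂ)⁻¹‖ₑ = (μ Set.univ)⁻¹ := by
    rw [enorm_inv hr, ← ofReal_norm, Complex.norm_real, Real.norm_of_nonneg measureReal_nonneg,
      Measure.real, ENNReal.ofReal_toReal hmt]
  rw [e1, enorm_neg, enorm_mul, e2, mul_pow]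
  calc (μ Set.univ)⁻¹ ^ 2 * ‖∫ y, (f y - c) ∂μ‖ₑ ^ 2
      ≤ (μ Set.univ)⁻¹ ^ 2 * (μ Set.univ * ∫⁻ y, ‖f y - c‖ₑ ^ 2 ∂μ) := by
        gcongr
        refine (pow_le_pow_left₀ (zero_le) (enorm_integral_le_lintegral_enorm _) 2).trans ?_
        exact lintegral_sq_le μ (hf.sub (integrable_const c)).aestronglyMeasurable.enorm
    _ = (μ Set.univ)⁻¹ * ∫⁻ y, ‖f y - c‖ₑ ^ 2 ∂μ := by
        rw [sq, mul_assoc, ← mul_assoc _ (μ Set.univ), ENNReal.inv_mul_cancel hm0 hmt, one_mul]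

/-! ### Translation of test functions -/

variable {d : ℕ} {Ω : Opens (EuclideanSpace ℝ (Fin d))}

theorem fderiv_test_apply (ψ : 𝓓(Ω, ℂ)) (x z : EuclideanSpace ℝ (Fin d)) :
    fderiv ℝ ψ x z = ∑ i, (z i : ℂ) * pd ψ i x := by
  conv_lhs => rw [← (EuclideanSpace.basisFun (Fin d) ℝ).sum_repr z]
  simp [pd]

theorem enorm_fderiv_test_sq_le (ψ : 𝓓(Ω, ℂ)) (x z : EuclideanSpace ℝ (Fin d)) :
    ‖fderiv ℝ ψ x z‖ₑ ^ 2 ≤ ‖z‖ₑ ^ 2 * ∑ i, ‖pd ψ i x‖ₑ ^ 2 := by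
  have h : ‖fderiv ℝ ψ x z‖ ^ 2 ≤ ‖z‖ ^ 2 * ∑ i, ‖pd ψ i x‖ ^ 2 := by
    rw [fderiv_test_apply, EuclideanSpace.norm_sq_eq]
    refine (pow_le_pow_left₀ (norm_nonneg _) (norm_sum_le _ _) 2).trans ?_
    simp_rw [norm_mul, Complex.norm_real]
    exact Finset.sum_mul_sq_le_sq_mul_sq _ _ _
  have h2 := ENNReal.ofReal_le_ofReal h
  rw [ENNReal.ofReal_mul (by positivity), ENNReal.ofReal_sum_of_nonneg fun i _ => by positivity]
    at h2
  simpa only [ENNReal.ofReal_pow (norm_nonneg _), ofReal_norm] using h2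

/-- The `L²` distance of a test function to its translate by `z` is at most `‖z‖` times the `L²` norm
of its gradient. -/
theorem lintegral_enorm_translate_sub_sq_le (ψ : 𝓓(Ω, ℂ)) (z : EuclideanSpace ℝ (Fin d)) :
    ∫⁻ x, ‖ψ (x + z) - ψ x‖ₑ ^ 2 ≤ ‖z‖ₑ ^ 2 * ∫⁻ x, ∑ i, ‖pd ψ i x‖ₑ ^ 2 := by
  have hD : Continuous fun p : EuclideanSpace ℝ (Fin d) × ℝ => fderiv ℝ ψ (p.1 + p.2 • z) z :=
    ((ψ.contDiff.continuous_fderiv (by simp)).comp (by fun_prop)).clm_apply continuous_const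
  have hg : Measurable fun x => ∑ i, ‖pd ψ i x‖ₑ ^ 2 :=
    Finset.measurable_fun_sum _ fun i _ => (continuous_pd ψ i).measurable.enorm.pow_const 2
  have hpt : ∀ x, ‖ψ (x + z) - ψ x‖ₑ ^ 2
      ≤ ∫⁻ t in Set.Ioc (0 : ℝ) 1, ‖fderiv ℝ ψ (x + t • z) z‖ₑ ^ 2 := by
    intro x
    have hDx : Continuous fun t : ℝ => fderiv ℝ ψ (x + t • z) z :=
      hD.comp (by fun_prop : Continuous fun t : ℝ => (x, t))
    have hderiv : ∀ t ∈ Set.uIcc (0 : ℝ) 1,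
        HasDerivAt (fun t : ℝ => ψ (x + t • z)) (fderiv ℝ ψ (x + t • z) z) t := by
      intro t _
      have h1 : HasDerivAt (fun t : ℝ => x + t • z) z t := by
        simpa using ((hasDerivAt_id t).smul_const z).const_add x
      exact (differentiable_test ψ _).hasFDerivAt.comp_hasDerivAt t h1
    have h := intervalIntegral.integral_eq_sub_of_hasDerivAt hderiv
      (hDx.intervalIntegrable 0 1)
    rw [one_smul, zero_smul, add_zero, intervalIntegral.integral_of_le zero_le_one] at h
    rw [← h]
    refine (pow_le_pow_left₀ (zero_le) (enorm_integral_le_lintegral_enorm _) 2).trans ?_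
    refine (lintegral_sq_le _ hDx.measurable.enorm.aemeasurable).trans ?_
    simp
  calc ∫⁻ x, ‖ψ (x + z) - ψ x‖ₑ ^ 2
      ≤ ∫⁻ x, ∫⁻ t in Set.Ioc (0 : ℝ) 1, ‖fderiv ℝ ψ (x + t • z) z‖ₑ ^ 2 := lintegral_mono hpt
    _ = ∫⁻ t in Set.Ioc (0 : ℝ) 1, ∫⁻ x, ‖fderiv ℝ ψ (x + t • z) z‖ₑ ^ 2 :=
        lintegral_lintegral_swap (hD.measurable.enorm.pow_const 2).aemeasurable
    _ ≤ ∫⁻ t in Set.Ioc (0 : ℝ) 1, ‖z‖ₑ ^ 2 * ∫⁻ x, ∑ i, ‖pd ψ i x‖ₑ ^ 2 := by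
        refine lintegral_mono fun t => ?_
        rw [lintegral_add_right_eq_self (fun x => ‖fderiv ℝ ψ x z‖ₑ ^ 2) (t • z),
          ← lintegral_const_mul _ hg]
        exact lintegral_mono fun x => enorm_fderiv_test_sq_le ψ x z
    _ = ‖z‖ₑ ^ 2 * ∫⁻ x, ∑ i, ‖pd ψ i x‖ₑ ^ 2 := by simp

theorem lintegral_pd_sq_le (ψ : 𝓓(Ω, ℂ)) :
    ∫⁻ x, ∑ i, ‖pd ψ i x‖ₑ ^ 2 ≤ ‖testH1 ψ‖ₑ ^ 2 := by
  have h1 : ∫⁻ x, ∑ i, ‖pd ψ i x‖ₑ ^ 2 = ∑ i, ‖grad (testH1 ψ) i‖ₑ ^ 2 := by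
    rw [lintegral_finsetSum _ fun i _ => (continuous_pd ψ i).measurable.enorm.pow_const 2]
    refine Finset.sum_congr rfl fun i _ => ?_
    have h2 : (fun x => ‖pd ψ i x‖ₑ ^ 2) = (Ω : Set _).indicator fun x => ‖pd ψ i x‖ₑ ^ 2 :=
      (Set.indicator_eq_self.2 fun x hx => by
        by_contra h
        exact hx (by simp [pd_eq_zero ψ i h])).symm
    rw [enorm_sq_Lp_two, h2, lintegral_indicator Ω.isOpen.measurableSet]
    refine lintegral_congr_ae ?_
    filter_upwards [coeFn_grad_testH1 ψ i] with x hx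
    rw [hx]
  have h2 := ENNReal.ofReal_le_ofReal
    ((le_add_of_nonneg_left (sq_nonneg ‖val (testH1 ψ)‖)).trans (norm_sq_H1 (testH1 ψ)).ge)
  rw [ENNReal.ofReal_sum_of_nonneg fun i _ => by positivity] at h2
  simp only [ENNReal.ofReal_pow (norm_nonneg _), ofReal_norm] at h2
  exact h1.trans_le h2

/-! ### Compactness of the embedding of `H¹₀` into `L²` -/

/-- The half-open box with lower corner `a` and upper corner `b`. -/
def box (a b : Fin d → ℝ) : Set (EuclideanSpace ℝ (Fin d)) :=
  {x | ∀ i, x i ∈ Set.Ico (a i) (b i)}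

theorem box_eq_preimage (a b : Fin d → ℝ) :
    box a b = WithLp.ofLp ⁻¹' (Set.univ.pi fun i => Set.Ico (a i) (b i)) := by
  ext x
  simp [box]

theorem measurableSet_box (a b : Fin d → ℝ) : MeasurableSet (box a b) := by
  rw [box_eq_preimage]
  exact (PiLp.volume_preserving_ofLp (Fin d)).measurable
    (MeasurableSet.univ_pi fun i => measurableSet_Ico)

theorem volume_box (a b : Fin d → ℝ) : volume (box a b) = ∏ i, ENNReal.ofReal (b i - a i) := by
  rw [box_eq_preimage, (PiLp.volume_preserving_ofLp (Fin d)).measure_preimage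
    (MeasurableSet.univ_pi fun i => measurableSet_Ico).nullMeasurableSet, Real.volume_pi_Ico]

/-- The cell with index `n` of the cubical grid of side `h`. -/
def cell (h : ℝ) (n : Fin d → ℤ) : Set (EuclideanSpace ℝ (Fin d)) :=
  box (fun i => n i * h) (fun i => n i * h + h)

theorem measurableSet_cell (h : ℝ) (n : Fin d → ℤ) : MeasurableSet (cell h n) :=
  measurableSet_box _ _

theorem volume_cell (h : ℝ) (n : Fin d → ℤ) : volume (cell h n) = ENNReal.ofReal h ^ d := by
  simp [cell, volume_box]

theorem mem_cell_iff {h : ℝ} (hh : 0 < h) {n : Fin d → ℤ} {x : EuclideanSpace ℝ (Fin d)} :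
    x ∈ cell h n ↔ ∀ i, n i = ⌊x i / h⌋ := by
  refine forall_congr' fun i => ?_
  rw [eq_comm, Int.floor_eq_iff, le_div_iff₀ hh, div_lt_iff₀ hh, add_mul, one_mul, Set.mem_Ico]

theorem vol_cell_ne_top (Ω : Opens (EuclideanSpace ℝ (Fin d))) (h : ℝ) (n : Fin d → ℤ) :
    vol Ω (cell h n) ≠ ∞ :=
  ne_top_of_le_ne_top (by rw [volume_cell]; finiteness) (Measure.restrict_apply_le _ _)

/-- The averaging operator that replaces a function on `Ω`, extended by zero, by its means over the
cells of side `h` with index in `F`. -/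
noncomputable def cellAverage (Ω : Opens (EuclideanSpace ℝ (Fin d))) (h : ℝ)
    (F : Finset (Fin d → ℤ)) : Lp ℂ 2 (vol Ω) →L[ℂ] Lp ℂ 2 (vol Ω) :=
  ∑ n ∈ F, ContinuousLinearMap.toSpanSingleton ℂ
      (((h ^ d : ℝ) : ℂ)⁻¹ •
        indicatorConstLp 2 (measurableSet_cell h n) (vol_cell_ne_top Ω h n) (1 : ℂ)) ∘L
    innerSL ℂ (indicatorConstLp 2 (measurableSet_cell h n) (vol_cell_ne_top Ω h n) (1 : ℂ))

theorem isCompactOperator_cellAverage (h : ℝ) (F : Finset (Fin d → ℤ)) :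
    IsCompactOperator (cellAverage Ω h F) := by
  have : cellAverage Ω h F ∈
        compactOperator (RingHom.id ℂ) (Lp ℂ 2 (vol Ω)) (Lp ℂ 2 (vol Ω)) := by
    refine Submodule.sum_mem _ fun n _ => ?_
    exact (isCompactOperator_of_locallyCompactSpace_dom (innerSL ℂ (indicatorConstLp 2
      (measurableSet_cell h n) (vol_cell_ne_top Ω h n) (1 : ℂ)))).clm_comp
        (ContinuousLinearMap.toSpanSingleton ℂ _)
  exact this

theorem coeFn_cellAverage {h : ℝ} (hh : 0 < h) {F : Finset (Fin d → ℤ)}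
    (hF : ∀ x ∈ Ω, (fun i => ⌊x i / h⌋) ∈ F) (f : Lp ℂ 2 (vol Ω)) :
    ∀ᵐ x ∂(vol Ω), cellAverage Ω h F f x
      = ((h ^ d : ℝ) : ℂ)⁻¹ * ∫ y in cell h (fun i => ⌊x i / h⌋), f y ∂(vol Ω) := by
  set e : (Fin d → ℤ) → Lp ℂ 2 (vol Ω) := fun n =>
    indicatorConstLp 2 (measurableSet_cell h n) (vol_cell_ne_top Ω h n) (1 : ℂ) with he
  have h1 : cellAverage Ω h F f
      = ∑ n ∈ F, (((h ^ d : ℝ) : ℂ)⁻¹ * ∫ y in cell h n, f y ∂(vol Ω)) • e n := by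
    simp only [cellAverage, sum_apply, ContinuousLinearMap.comp_apply,
      ContinuousLinearMap.toSpanSingleton_apply, innerSL_apply_apply, smul_smul]
    refine Finset.sum_congr rfl fun n _ => ?_
    rw [L2.inner_indicatorConstLp_one, mul_comm]
  have h2 : ∀ n ∈ F, ∀ᵐ x ∂(vol Ω),
      ((((h ^ d : ℝ) : ℂ)⁻¹ * ∫ y in cell h n, f y ∂(vol Ω)) • e n : Lp ℂ 2 (vol Ω)) x
        = (cell h n).indicator
            (fun _ => ((h ^ d : ℝ) : ℂ)⁻¹ * ∫ y in cell h n, f y ∂(vol Ω)) x := by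
    intro n _
    filter_upwards [Lp.coeFn_smul (((h ^ d : ℝ) : ℂ)⁻¹ * ∫ y in cell h n, f y ∂(vol Ω)) (e n),
      indicatorConstLp_coeFn (p := 2) (hs := measurableSet_cell h n)
        (hμs := vol_cell_ne_top Ω h n) (c := (1 : ℂ))] with x hx1 hx2
    rw [hx1, Pi.smul_apply, he, hx2]
    by_cases hx : x ∈ cell h n <;> simp [hx]
  filter_upwards [(Finset.eventually_all F).2 h2, ae_restrict_mem Ω.isOpen.measurableSet,
    Lp.coeFn_finsetSum F
      fun n => (((h ^ d : ℝ) : ℂ)⁻¹ * ∫ y in cell h n, f y ∂(vol Ω)) • e n] with x hx1 hx2 hx3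
  rw [h1, hx3, Finset.sum_apply, Finset.sum_congr rfl hx1,
    Finset.sum_eq_single_of_mem _ (hF x hx2) fun n _ hn => ?_]
  · rw [Set.indicator_of_mem ((mem_cell_iff hh).2 fun _ => rfl)]
  · exact Set.indicator_of_notMem (fun hx => hn (funext ((mem_cell_iff hh).1 hx))) _

/-- The cells of a grid that meet a bounded set are finite in number. -/
theorem exists_finset_cells (hΩ : Bornology.IsBounded (Ω : Set (EuclideanSpace ℝ (Fin d)))) {h : ℝ}
    (hh : 0 < h) : ∃ F : Finset (Fin d → ℤ), ∀ x ∈ Ω, (fun i => ⌊x i / h⌋) ∈ F := by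
  obtain ⟨R, hR⟩ := hΩ.exists_norm_le
  refine ⟨Finset.Icc (fun _ => ⌊-R / h⌋) (fun _ => ⌊R / h⌋), fun x hx => ?_⟩
  have hxi : ∀ i, |x i| ≤ R := fun i => (PiLp.norm_apply_le x i).trans (hR x hx)
  refine Finset.mem_Icc.2 ⟨fun i => ?_, fun i => ?_⟩
  · exact Int.floor_mono (by gcongr; exact (abs_le.1 (hxi i)).1)
  · exact Int.floor_mono (by gcongr; exact (abs_le.1 (hxi i)).2)

/-- On a cell, a test function differs from its mean by at most the mean of its translation
differences over a box of twice the size. -/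
theorem enorm_test_sub_cell_average_sq_le (ψ : 𝓓(Ω, ℂ)) {h : ℝ} (hh : 0 < h) {n : Fin d → ℤ}
    {x : EuclideanSpace ℝ (Fin d)} (hx : x ∈ cell h n) :
    ‖ψ x - ((h ^ d : ℝ) : ℂ)⁻¹ * ∫ y in cell h n, ψ y‖ₑ ^ 2
      ≤ (ENNReal.ofReal h ^ d)⁻¹ *
        ∫⁻ z in box (fun _ : Fin d => -h) (fun _ => h), ‖ψ (x + z) - ψ x‖ₑ ^ 2 := by
  have hv : volume.restrict (cell h n) Set.univ = ENNReal.ofReal h ^ d := by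
    rw [Measure.restrict_apply_univ, volume_cell]
  have hvr : (volume.restrict (cell h n)).real Set.univ = h ^ d := by
    rw [Measure.real, hv, ENNReal.toReal_pow, ENNReal.toReal_ofReal hh.le]
  have : IsFiniteMeasure (volume.restrict (cell h n)) := ⟨by rw [hv]; finiteness⟩
  have : NeZero (volume.restrict (cell h n)) :=
    ⟨Measure.measure_univ_ne_zero.1 (by rw [hv]; exact pow_ne_zero _ (by simpa using hh))⟩
  have hint : Integrable ψ (volume.restrict (cell h n)) :=
    (ψ.continuous.integrable_of_hasCompactSupport ψ.hasCompactSupport).restrict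
  have key := enorm_sub_average_sq_le hint (ψ x)
  rw [hv, hvr] at key
  refine key.trans ?_
  refine mul_le_mul_right ?_ _
  rw [← lintegral_indicator (measurableSet_cell h n), ← lintegral_indicator (measurableSet_box _ _),
    ← lintegral_add_left_eq_self _ x]
  refine lintegral_mono fun z => ?_
  by_cases hz : x + z ∈ cell h n
  · have hzb : z ∈ box (fun _ : Fin d => -h) (fun _ => h) := fun i => by
      have h1 := hx i
      have h2 := hz i
      simp only [PiLp.add_apply, Set.mem_Ico] at h1 h2
      exact ⟨by linarith, by linarith⟩
    rw [Set.indicator_of_mem hz, Set.indicator_of_mem hzb]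
  · rw [Set.indicator_of_notMem hz]
    exact zero_le

/-- The factor `2 ^ d` is the volume ratio of the box of translations to a cell, and `√d * h` bounds
the length of such a translation. -/
theorem norm_val_sub_cellAverage_le (ψ : 𝓓(Ω, ℂ)) {h : ℝ} (hh : 0 < h) {F : Finset (Fin d → ℤ)}
    (hF : ∀ x ∈ Ω, (fun i => ⌊x i / h⌋) ∈ F) :
    ‖val (testH1 ψ) - cellAverage Ω h F (val (testH1 ψ))‖
      ≤ Real.sqrt (2 ^ d * d) * h * ‖testH1 ψ‖ := by
  have hmt : ENNReal.ofReal h ^ d ≠ ∞ := by finiteness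
  have hm0 : ENNReal.ofReal h ^ d ≠ 0 := pow_ne_zero _ (by simpa using hh)
  have hcont : Continuous fun p : EuclideanSpace ℝ (Fin d) × EuclideanSpace ℝ (Fin d) =>
      ψ (p.1 + p.2) - ψ p.1 :=
    (ψ.continuous.comp (by fun_prop)).sub (ψ.continuous.comp (by fun_prop))
  have hz : ∀ z ∈ box (fun _ : Fin d => -h) (fun _ => h),
      ∫⁻ x, ‖ψ (x + z) - ψ x‖ₑ ^ 2 ≤ ENNReal.ofReal (d * h ^ 2) * ‖testH1 ψ‖ₑ ^ 2 := by
    intro z hz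
    refine (lintegral_enorm_translate_sub_sq_le ψ z).trans ?_
    gcongr
    · rw [← ofReal_norm, ← ENNReal.ofReal_pow (norm_nonneg _)]
      refine ENNReal.ofReal_le_ofReal ?_
      rw [EuclideanSpace.norm_sq_eq]
      calc ∑ i, ‖z i‖ ^ 2 ≤ ∑ _i : Fin d, h ^ 2 := by
            refine Finset.sum_le_sum fun i _ => ?_
            rw [Real.norm_eq_abs]
            exact pow_le_pow_left₀ (abs_nonneg _) (abs_le.2 ⟨(hz i).1, (hz i).2.le⟩) 2
        _ = d * h ^ 2 := by simp
    · exact lintegral_pd_sq_le ψ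
  have hpt : ∀ᵐ x ∂(vol Ω),
      ‖(val (testH1 ψ) - cellAverage Ω h F (val (testH1 ψ))) x‖ₑ ^ 2
        ≤ (ENNReal.ofReal h ^ d)⁻¹ *
          ∫⁻ z in box (fun _ : Fin d => -h) (fun _ => h), ‖ψ (x + z) - ψ x‖ₑ ^ 2 := by
    filter_upwards [coeFn_cellAverage hh hF (val (testH1 ψ)), coeFn_val_testH1 ψ,
      Lp.coeFn_sub (val (testH1 ψ)) (cellAverage Ω h F (val (testH1 ψ)))] with x h1 h2 h3
    set n : Fin d → ℤ := fun i => ⌊x i / h⌋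
    -- The mean over the part of the cell in `Ω` may be taken over the whole cell.
    have h4 : ∫ y in cell h n, val (testH1 ψ) y ∂(vol Ω) = ∫ y in cell h n, ψ y := by
      have e1 : ∫ y in cell h n, val (testH1 ψ) y ∂(vol Ω) = ∫ y in cell h n, ψ y ∂(vol Ω) :=
        integral_congr_ae (ae_restrict_of_ae (coeFn_val_testH1 ψ))
      rw [e1, vol, Measure.restrict_restrict (measurableSet_cell h n), Set.inter_comm,
        ← Measure.restrict_restrict Ω.isOpen.measurableSet]
      exact setIntegral_eq_integral_of_forall_compl_eq_zero fun y hy => test_eq_zero ψ hy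
    rw [h3, Pi.sub_apply, h1, h2, h4]
    exact enorm_test_sub_cell_average_sq_le ψ hh ((mem_cell_iff hh).2 fun _ => rfl)
  have hsq : ‖val (testH1 ψ) - cellAverage Ω h F (val (testH1 ψ))‖ₑ ^ 2
      ≤ ENNReal.ofReal (2 ^ d * d * h ^ 2) * ‖testH1 ψ‖ₑ ^ 2 := by
    calc ‖val (testH1 ψ) - cellAverage Ω h F (val (testH1 ψ))‖ₑ ^ 2
        ≤ ∫⁻ x, (ENNReal.ofReal h ^ d)⁻¹ *
            ∫⁻ z in box (fun _ : Fin d => -h) (fun _ => h), ‖ψ (x + z) - ψ x‖ₑ ^ 2 := by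
          rw [enorm_sq_Lp_two]
          exact (lintegral_mono_ae hpt).trans (lintegral_mono' Measure.restrict_le_self le_rfl)
      _ = (ENNReal.ofReal h ^ d)⁻¹ *
            ∫⁻ z in box (fun _ : Fin d => -h) (fun _ => h), ∫⁻ x, ‖ψ (x + z) - ψ x‖ₑ ^ 2 := by
          rw [lintegral_const_mul' _ _ (ENNReal.inv_ne_top.2 hm0), lintegral_lintegral_swap]
          exact (hcont.measurable.enorm.pow_const 2).aemeasurable
      _ ≤ (ENNReal.ofReal h ^ d)⁻¹ * ∫⁻ z in box (fun _ : Fin d => -h) (fun _ => h),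
            ENNReal.ofReal (d * h ^ 2) * ‖testH1 ψ‖ₑ ^ 2 := by
          gcongr 1
          exact setLIntegral_mono' (measurableSet_box _ _) hz
      _ = ENNReal.ofReal (2 ^ d * d * h ^ 2) * ‖testH1 ψ‖ₑ ^ 2 := by
          have h2 : ∏ _i : Fin d, ENNReal.ofReal (h - -h)
              = ENNReal.ofReal (2 ^ d) * ENNReal.ofReal h ^ d := by
            rw [Finset.prod_const, Finset.card_univ, Fintype.card_fin, sub_neg_eq_add, ← two_mul,
              ENNReal.ofReal_mul zero_le_two, mul_pow, ENNReal.ofReal_pow zero_le_two]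
          rw [setLIntegral_const, volume_box, h2, mul_assoc (2 ^ d : ℝ),
            ENNReal.ofReal_mul (p := 2 ^ d) (by positivity)]
          calc (ENNReal.ofReal h ^ d)⁻¹ * (ENNReal.ofReal (d * h ^ 2) * ‖testH1 ψ‖ₑ ^ 2 *
                (ENNReal.ofReal (2 ^ d) * ENNReal.ofReal h ^ d))
              = ((ENNReal.ofReal h ^ d)⁻¹ * ENNReal.ofReal h ^ d) *
                (ENNReal.ofReal (2 ^ d) * ENNReal.ofReal (d * h ^ 2) * ‖testH1 ψ‖ₑ ^ 2) := by ring
            _ = _ := by rw [ENNReal.inv_mul_cancel hm0 hmt, one_mul]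
  have hreal := ENNReal.toReal_mono (by finiteness) hsq
  rw [ENNReal.toReal_mul, ENNReal.toReal_pow, ENNReal.toReal_pow, toReal_enorm, toReal_enorm,
    ENNReal.toReal_ofReal (by positivity)] at hreal
  refine (sq_le_sq₀ (norm_nonneg _) (by positivity)).1 ?_
  rw [mul_pow, mul_pow, Real.sq_sqrt (by positivity)]
  exact hreal

-- `H10 Ω` is a submodule of a submodule, and its normed structure is found only at this depth.
set_option maxSynthPendingDepth 5 in
/-- Rellich's theorem: `H¹₀(Ω)` embeds compactly into `L²(Ω)` when `Ω` is bounded, because the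
averages over the cells of a grid of side `h` have finite rank and approximate the embedding to
order `h`. -/
theorem isCompactOperator_valL (hΩ : Bornology.IsBounded (Ω : Set (EuclideanSpace ℝ (Fin d)))) :
    IsCompactOperator (valL Ω ∘L (H10 Ω).subtypeL) := by
  set T := valL Ω ∘L (H10 Ω).subtypeL with hT
  have hpos : ∀ k : ℕ, (0 : ℝ) < 1 / ((k : ℝ) + 1) := fun k => Nat.one_div_pos_of_nat
  choose F hF using fun k : ℕ => exists_finset_cells hΩ (hpos k)
  have hle : ∀ k : ℕ, ‖cellAverage Ω (1 / ((k : ℝ) + 1)) (F k) ∘L T - T‖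
      ≤ Real.sqrt (2 ^ d * d) * (1 / ((k : ℝ) + 1)) := by
    intro k
    refine ContinuousLinearMap.opNorm_le_bound _ (by positivity) fun u => ?_
    rw [← norm_neg, ← neg_apply, neg_sub]
    refine H10_induction (P := fun u => ‖valL Ω u
      - cellAverage Ω (1 / ((k : ℝ) + 1)) (F k) (valL Ω u)‖
        ≤ Real.sqrt (2 ^ d * d) * (1 / ((k : ℝ) + 1)) * ‖u‖) ?_ ?_ u.2
    · exact isClosed_le (by fun_prop) (by fun_prop)
    · exact fun ψ => norm_val_sub_cellAverage_le ψ (hpos k) (hF k)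
  have hlim : Tendsto (fun k : ℕ => cellAverage Ω (1 / ((k : ℝ) + 1)) (F k) ∘L T) atTop (𝓝 T) := by
    rw [tendsto_iff_norm_sub_tendsto_zero]
    refine squeeze_zero (fun _ => norm_nonneg _) hle ?_
    simpa using tendsto_one_div_add_atTop_nhds_zero_nat.const_mul (Real.sqrt (2 ^ d * d))
  exact isCompactOperator_of_tendsto hlim (Eventually.of_forall fun k =>
    (isCompactOperator_cellAverage _ (F k)).comp_clm T)

/-! ### The forms of the equation -/

theorem isSelfAdjoint_mulL {α : Type*} [MeasurableSpace α] {μ : Measure α} {m : α → ℝ}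
    (h : MemLp (fun x => (m x : ℂ)) ⊤ μ) : IsSelfAdjoint (mulL μ m) := by
  rw [ContinuousLinearMap.isSelfAdjoint_iff_isSymmetric]
  intro f g
  simp only [ContinuousLinearMap.coe_coe]
  rw [inner_mulL h, ← inner_conj_symm, inner_mulL h, ← integral_conj]
  refine integral_congr_ae (Eventually.of_forall fun x => ?_)
  simp only [map_mul, Complex.conj_ofReal, Complex.conj_conj]
  ring

theorem norm_sq_eq_integral {α : Type*} [MeasurableSpace α] {μ : Measure α} (f : Lp ℂ 2 μ) :
    ‖f‖ ^ 2 = ∫ x, ‖f x‖ ^ 2 ∂μ := by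
  rw [@norm_sq_eq_re_inner ℂ, L2.inner_def, ← integral_re (L2.integrable_inner f f)]
  simp_rw [← norm_sq_eq_re_inner]

namespace Coeff

-- `H10 Ω` is a submodule of a submodule, and its normed structure is found only at this depth.
set_option maxSynthPendingDepth 5

variable {d : ℕ} {Ω : Opens (EuclideanSpace ℝ (Fin d))} (M : Coeff Ω)

theorem memLp_a (i j : Fin d) : MemLp (fun x => (M.a x i j : ℂ)) ⊤ (vol Ω) := by
  obtain ⟨C, hC⟩ := M.a_bounded
  exact memLp_top_of_bound (Complex.continuous_ofReal.comp_aestronglyMeasurable (M.a_meas i j)) C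
    (hC.mono fun x hx => hx i j)

theorem memLp_q : MemLp (fun x => (M.q x : ℂ)) ⊤ (vol Ω) := by
  obtain ⟨β₁, β₂, h1, -, h⟩ := M.q_bounds
  refine memLp_top_of_bound (Complex.continuous_ofReal.comp_aestronglyMeasurable M.q_meas) β₂ ?_
  filter_upwards [h] with x hx
  rw [Complex.norm_real, Real.norm_eq_abs, abs_of_nonneg (h1.le.trans hx.1)]
  exact hx.2

/-- The operator on `H¹` that represents the sesquilinear form `∫ a ∇u · conj ∇v`. -/
noncomputable def formA : H1 Ω →L[ℂ] H1 Ω :=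
  ∑ i, ∑ j, ContinuousLinearMap.adjoint (gradL Ω i) ∘L
    mulL (vol Ω) (fun x => M.a x i j) ∘L gradL Ω j

/-- The operator on `H¹` that represents the sesquilinear form `∫ q u conj v`. -/
noncomputable def formQ : H1 Ω →L[ℂ] H1 Ω :=
  ContinuousLinearMap.adjoint (valL Ω) ∘L mulL (vol Ω) M.q ∘L valL Ω

theorem inner_formA (u v : H1 Ω) : ⟪v, M.formA u⟫_ℂ
    = ∫ x, ∑ i, ∑ j, (M.a x i j : ℂ) * grad u j x * conj (grad v i x) ∂(vol Ω) := by
  have hint := fun i j => integrable_inner_mulL (M.memLp_a i j) (grad u j) (grad v i)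
  rw [integral_finsetSum _ fun i _ => integrable_finsetSum _ fun j _ => hint i j]
  simp_rw [integral_finsetSum _ fun j _ => hint _ j]
  simp only [formA, sum_apply, inner_sum]
  refine Finset.sum_congr rfl fun i _ => Finset.sum_congr rfl fun j _ => ?_
  rw [ContinuousLinearMap.comp_apply, ContinuousLinearMap.adjoint_inner_right,
    ContinuousLinearMap.comp_apply, gradL_apply, gradL_apply, inner_mulL (M.memLp_a i j)]

theorem inner_formQ (u v : H1 Ω) : ⟪v, M.formQ u⟫_ℂ
    = ∫ x, (M.q x : ℂ) * val u x * conj (val v x) ∂(vol Ω) := by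
  rw [formQ, ContinuousLinearMap.comp_apply, ContinuousLinearMap.adjoint_inner_right,
    ContinuousLinearMap.comp_apply, valL_apply, valL_apply, inner_mulL M.memLp_q]

theorem isSymmetric_formQ : (M.formQ : H1 Ω →ₗ[ℂ] H1 Ω).IsSymmetric :=
  ((isSelfAdjoint_mulL M.memLp_q).adjoint_conj (valL Ω)).isSymmetric

theorem isSymmetric_formA : (M.formA : H1 Ω →ₗ[ℂ] H1 Ω).IsSymmetric := by
  intro u v
  simp only [ContinuousLinearMap.coe_coe]
  rw [← inner_conj_symm, inner_formA, inner_formA, ← integral_conj]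
  refine integral_congr_ae ?_
  filter_upwards [M.a_symm] with x hx
  simp only [map_sum, map_mul, Complex.conj_ofReal, Complex.conj_conj]
  rw [Finset.sum_comm]
  refine Finset.sum_congr rfl fun i _ => Finset.sum_congr rfl fun j _ => ?_
  rw [hx.apply i j]
  ring

/-- Ellipticity passes from real to complex vectors through real and imaginary parts. -/
theorem re_elliptic : ∃ lam : ℝ, 0 < lam ∧ ∀ᵐ x ∂(vol Ω), ∀ g : Fin d → ℂ,
    lam * ∑ i, ‖g i‖ ^ 2 ≤ (∑ i, ∑ j, (M.a x i j : ℂ) * g j * conj (g i)).re := by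
  obtain ⟨lam, Lam, hlam, -, h⟩ := M.a_elliptic
  refine ⟨lam, hlam, h.mono fun x hx g => ?_⟩
  have h1 := (hx fun i => (g i).re).1
  have h2 := (hx fun i => (g i).im).1
  have e1 : ∑ i, ‖g i‖ ^ 2 = ∑ i, (g i).re ^ 2 + ∑ i, (g i).im ^ 2 := by
    rw [← Finset.sum_add_distrib]
    refine Finset.sum_congr rfl fun i _ => ?_
    rw [← Complex.normSq_eq_norm_sq, Complex.normSq_apply]
    ring
  have e2 : (∑ i, ∑ j, (M.a x i j : ℂ) * g j * conj (g i)).re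
      = ∑ i, ∑ j, (g i).re * M.a x i j * (g j).re
        + ∑ i, ∑ j, (g i).im * M.a x i j * (g j).im := by
    simp only [Complex.re_sum, ← Finset.sum_add_distrib]
    refine Finset.sum_congr rfl fun i _ => Finset.sum_congr rfl fun j _ => ?_
    simp
    ring
  rw [e1, e2, mul_add]
  exact add_le_add h1 h2

/-- The form with spectral parameter `-1` is coercive on all of `H¹`. -/
theorem exists_coercive : ∃ c : ℝ, 0 < c ∧
    ∀ u : H1 Ω, c * ‖u‖ ^ 2 ≤ ‖⟪u, (M.formA + M.formQ) u⟫_ℂ‖ := by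
  obtain ⟨lam, hlam, hA⟩ := M.re_elliptic
  obtain ⟨β₁, β₂, hβ, -, hQ⟩ := M.q_bounds
  refine ⟨min lam β₁, lt_min hlam hβ, fun u => le_trans ?_ (Complex.re_le_norm _)⟩
  have hsq : ∀ f : Lp ℂ 2 (vol Ω), Integrable (fun x => ‖f x‖ ^ 2) (vol Ω) := fun f =>
    (memLp_two_iff_integrable_sq_norm (Lp.aestronglyMeasurable f)).1 (Lp.memLp f)
  have hiA : Integrable
      (fun x => ∑ i, ∑ j, (M.a x i j : ℂ) * grad u j x * conj (grad u i x)) (vol Ω) :=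
    integrable_finsetSum _ fun i _ => integrable_finsetSum _ fun j _ =>
      integrable_inner_mulL (M.memLp_a i j) (grad u j) (grad u i)
  have hiQ := integrable_inner_mulL M.memLp_q (val u) (val u)
  have h1 : lam * ∑ i, ‖grad u i‖ ^ 2 ≤ (⟪u, M.formA u⟫_ℂ).re := by
    rw [inner_formA]
    refine le_of_le_of_eq ?_ (integral_re hiA)
    simp_rw [norm_sq_eq_integral]
    rw [← integral_finsetSum _ fun i _ => hsq (grad u i), ← integral_const_mul]
    refine integral_mono_ae ((integrable_finsetSum _ fun i _ => hsq (grad u i)).const_mul _)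
      hiA.re ?_
    filter_upwards [hA] with x hx
    exact hx fun i => grad u i x
  have h2 : β₁ * ‖val u‖ ^ 2 ≤ (⟪u, M.formQ u⟫_ℂ).re := by
    rw [inner_formQ]
    refine le_of_le_of_eq ?_ (integral_re hiQ)
    rw [norm_sq_eq_integral, ← integral_const_mul]
    refine integral_mono_ae ((hsq (val u)).const_mul _) hiQ.re ?_
    filter_upwards [hQ] with x hx
    have e : (M.q x : ℂ) * val u x * conj (val u x) = ((M.q x * ‖val u x‖ ^ 2 : ℝ) : ℂ) := by
      rw [mul_assoc, Complex.mul_conj, Complex.normSq_eq_norm_sq, Complex.ofReal_mul]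
    rw [e]
    exact mul_le_mul_of_nonneg_right hx.1 (sq_nonneg _)
  rw [add_apply, inner_add_right, Complex.add_re, norm_sq_H1, mul_add, add_comm]
  exact add_le_add
    ((mul_le_mul_of_nonneg_right (min_le_left _ _)
      (Finset.sum_nonneg fun i _ => sq_nonneg _)).trans h1)
    ((mul_le_mul_of_nonneg_right (min_le_right _ _) (sq_nonneg _)).trans h2)

/-! ### Weak solutions -/

/-- Testing the bilinear weak formulation with `ψ` is testing the sesquilinear one with the
conjugate of `ψ`. -/
theorem inner_testH1_conjTest (k : ℂ) (u : H1 Ω) (ψ : 𝓓(Ω, ℂ)) :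
    ⟪testH1 (conjTest ψ), (M.formA - k • M.formQ) u⟫_ℂ
      = ∫ x, (∑ i, ∑ j, (M.a x i j : ℂ) * grad u j x * pd ψ i x) ∂(vol Ω)
        - k * ∫ x, (M.q x : ℂ) * val u x * ψ x ∂(vol Ω) := by
  rw [sub_apply, smul_apply, inner_sub_right, inner_smul_right, inner_formA, inner_formQ]
  congr 1
  · refine integral_congr_ae ?_
    filter_upwards [ae_all_iff.2 fun i => coeFn_grad_testH1 (conjTest ψ) i] with x hx
    simp_rw [hx, pd_conjTest, Complex.conj_conj]
  · congr 1
    refine integral_congr_ae ?_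
    filter_upwards [coeFn_val_testH1 (conjTest ψ)] with x hx
    rw [hx, conjTest_apply, Complex.conj_conj]

theorem isWeakSol_iff {k : ℂ} {u : H1 Ω} :
    M.IsWeakSol k u ↔ ∀ v : H10 Ω,
      ⟪(H10 Ω).subtypeL v, (M.formA - k • M.formQ) u⟫_ℂ = 0 := by
  constructor
  · intro h v
    refine H10_induction (P := fun v => ⟪v, (M.formA - k • M.formQ) u⟫_ℂ = 0)
      (isClosed_eq (by fun_prop) continuous_const) (fun ψ => ?_) v.2
    -- Every test function is the conjugate of one.
    have e : ψ = conjTest (conjTest ψ) := by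
      ext x
      simp [conjTest_apply]
    rw [e, inner_testH1_conjTest]
    exact h _
  · intro h ψ
    rw [← inner_testH1_conjTest]
    exact h ⟨_, testH1_mem_H10 _⟩

theorem spectrum_eq :
    M.spectrum = pencilSpectrum (H10 Ω).subtypeL M.formA M.formQ := by
  ext k
  constructor
  · rintro ⟨u, hu, hu0, h⟩
    exact ⟨⟨u, hu⟩, fun h0 => hu0 (congrArg Subtype.val h0), M.isWeakSol_iff.1 h⟩
  · rintro ⟨u, hu0, h⟩
    exact ⟨u, u.2, fun h0 => hu0 (Subtype.ext h0), M.isWeakSol_iff.2 h⟩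

theorem trace_eq_iff {u w : H1 Ω} : trace u = trace w ↔ u - w ∈ H10 Ω :=
  Submodule.Quotient.eq _

theorem exists_coercive_H10 : ∃ c : ℝ, 0 < c ∧ ∀ u : H10 Ω, c * ‖u‖ ^ 2
    ≤ ‖⟪(H10 Ω).subtypeL u, (M.formA + M.formQ) ((H10 Ω).subtypeL u)⟫_ℂ‖ := by
  obtain ⟨c, hc, h⟩ := M.exists_coercive
  exact ⟨c, hc, fun u => h u⟩

theorem isCompactOperator_formQ (hΩ : Bornology.IsBounded (Ω : Set (EuclideanSpace ℝ (Fin d)))) :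
    IsCompactOperator (M.formQ ∘L (H10 Ω).subtypeL) :=
  (isCompactOperator_valL hΩ).clm_comp
    (ContinuousLinearMap.adjoint (valL Ω) ∘L mulL (vol Ω) M.q)

theorem isClosed_spectrum (hΩ : Bornology.IsBounded (Ω : Set (EuclideanSpace ℝ (Fin d)))) :
    IsClosed M.spectrum := by
  obtain ⟨c, hc, h⟩ := M.exists_coercive_H10
  rw [spectrum_eq]
  exact isClosed_pencilSpectrum hc h (M.isCompactOperator_formQ hΩ)

theorem spectrum_subset_real {k : ℂ} (hk : k ∈ M.spectrum) : k.im = 0 := by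
  obtain ⟨c, hc, h⟩ := M.exists_coercive_H10
  rw [spectrum_eq] at hk
  exact pencilSpectrum_subset_real hc h M.isSymmetric_formA M.isSymmetric_formQ hk

theorem neg_one_notMem_spectrum : -1 ∉ M.spectrum := by
  obtain ⟨c, hc, h⟩ := M.exists_coercive_H10
  rw [spectrum_eq]
  exact neg_one_notMem_pencilSpectrum hc h

theorem isSolution_unique {k : ℂ} (hk : k ∉ M.spectrum) {φ : HHalf Ω} {u w : H1 Ω}
    (hu : M.IsSolution k φ u) (hw : M.IsSolution k φ w) : u = w := by
  rw [spectrum_eq] at hk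
  exact eq_of_notMem_pencilSpectrum hk
    (e := ⟨u - w, trace_eq_iff.1 (hu.2.trans hw.2.symm)⟩) rfl
    (M.isWeakSol_iff.1 hu.1) (M.isWeakSol_iff.1 hw.1)

theorem exists_analyticOnNhd_isSolution
    (hΩ : Bornology.IsBounded (Ω : Set (EuclideanSpace ℝ (Fin d)))) (φ : HHalf Ω) :
    ∃ s : ℂ → H1 Ω, AnalyticOnNhd ℂ s M.spectrumᶜ ∧ ∀ k ∈ M.spectrumᶜ, M.IsSolution k φ (s k) := by
  obtain ⟨Φ, hΦ⟩ : ∃ Φ : H1 Ω, trace Φ = φ := (H10 Ω).mkQ_surjective φ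
  obtain ⟨c, hc, h⟩ := M.exists_coercive_H10
  rw [M.spectrum_eq]
  obtain ⟨s, hs, hsol⟩ := exists_analyticOnNhd_solution hc h (M.isCompactOperator_formQ hΩ) Φ
  refine ⟨s, hs, fun k hk => ?_⟩
  obtain ⟨⟨e, he⟩, h0⟩ := hsol k hk
  refine ⟨M.isWeakSol_iff.2 h0, ?_⟩
  have hmem : s k - Φ ∈ H10 Ω := by
    rw [he, sub_sub_cancel_left]
    exact (H10 Ω).neg_mem e.2
  exact (trace_eq_iff.2 hmem).trans hΦ

theorem isSolution_sol (hΩ : Bornology.IsBounded (Ω : Set (EuclideanSpace ℝ (Fin d)))) {k : ℂ}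
    (hk : k ∈ M.spectrumᶜ) (φ : HHalf Ω) : M.IsSolution k φ (M.sol k φ) := by
  obtain ⟨s, -, hs⟩ := M.exists_analyticOnNhd_isSolution hΩ φ
  have h : ∃ u, M.IsSolution k φ u := ⟨_, hs k hk⟩
  rw [sol, dif_pos h]
  exact h.choose_spec

theorem analyticOnNhd_sol (hΩ : Bornology.IsBounded (Ω : Set (EuclideanSpace ℝ (Fin d))))
    (φ : HHalf Ω) : AnalyticOnNhd ℂ (fun k => M.sol k φ) M.spectrumᶜ := by
  obtain ⟨s, hs, hsol⟩ := M.exists_analyticOnNhd_isSolution hΩ φ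
  exact hs.congr (M.isClosed_spectrum hΩ).isOpen_compl fun k hk =>
    M.isSolution_unique hk (hsol k hk) (M.isSolution_sol hΩ hk φ)

/-! ### Internal energies -/

theorem energy_eq (φ ψ : HHalf Ω) (k : ℂ) : M.energy φ ψ k
    = mulL2L1 (vol Ω) (mulL (vol Ω) M.q (valL Ω (M.sol k φ))) (valL Ω (M.sol k ψ)) := by
  refine Lp.ext ?_
  filter_upwards [(M.integrable_energy (M.sol k φ) (M.sol k ψ)).coeFn_toL1,
    coeFn_mulL2L1 (mulL (vol Ω) M.q (valL Ω (M.sol k φ))) (valL Ω (M.sol k ψ)),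
    coeFn_mulL M.memLp_q (valL Ω (M.sol k φ))] with x h1 h2 h3
  rw [energy, h1, h2, h3]
  rfl

theorem gradEnergy_eq (φ ψ : HHalf Ω) (k : ℂ) : M.gradEnergy φ ψ k
    = ∑ i, ∑ j, mulL2L1 (vol Ω) (mulL (vol Ω) (fun x => M.a x i j) (gradL Ω j (M.sol k φ)))
        (gradL Ω i (M.sol k ψ)) := by
  refine Lp.ext ?_
  have h2 : ∀ᵐ x ∂(vol Ω), ∀ i j,
      mulL2L1 (vol Ω) (mulL (vol Ω) (fun x => M.a x i j) (gradL Ω j (M.sol k φ)))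
        (gradL Ω i (M.sol k ψ)) x
      = (M.a x i j : ℂ) * grad (M.sol k φ) j x * grad (M.sol k ψ) i x := by
    refine ae_all_iff.2 fun i => ae_all_iff.2 fun j => ?_
    filter_upwards [coeFn_mulL2L1 (mulL (vol Ω) (fun x => M.a x i j) (gradL Ω j (M.sol k φ)))
        (gradL Ω i (M.sol k ψ)),
      coeFn_mulL (M.memLp_a i j) (gradL Ω j (M.sol k φ))] with x h1 h2
    rw [h1, h2]
    rfl
  have h3 : ∀ᵐ x ∂(vol Ω), ∀ i,
      (∑ j, mulL2L1 (vol Ω) (mulL (vol Ω) (fun x => M.a x i j) (gradL Ω j (M.sol k φ)))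
        (gradL Ω i (M.sol k ψ)) : Lp ℂ 1 (vol Ω)) x
      = ∑ j, mulL2L1 (vol Ω) (mulL (vol Ω) (fun x => M.a x i j) (gradL Ω j (M.sol k φ)))
        (gradL Ω i (M.sol k ψ)) x :=
    ae_all_iff.2 fun i => (Lp.coeFn_finsetSum _ _).mono fun x hx => by
      rw [hx, Finset.sum_apply]
  filter_upwards [(M.integrable_gradEnergy (M.sol k φ) (M.sol k ψ)).coeFn_toL1, h2, h3,
    Lp.coeFn_finsetSum Finset.univ fun i =>
      ∑ j, mulL2L1 (vol Ω) (mulL (vol Ω) (fun x => M.a x i j) (gradL Ω j (M.sol k φ)))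
        (gradL Ω i (M.sol k ψ))] with x h1 h2 h3 h4
  rw [gradEnergy, h1, h4, Finset.sum_apply]
  simp_rw [h3, h2]

theorem analyticOnNhd_energy (hΩ : Bornology.IsBounded (Ω : Set (EuclideanSpace ℝ (Fin d))))
    (φ ψ : HHalf Ω) : AnalyticOnNhd ℂ (M.energy φ ψ) M.spectrumᶜ := by
  intro k hk
  rw [funext (M.energy_eq φ ψ)]
  exact AnalyticAt.comp₂ ((mulL2L1 (vol Ω)).analyticAt_bilinear _)
    (((mulL (vol Ω) M.q ∘L valL Ω).analyticAt _).fun_comp (M.analyticOnNhd_sol hΩ φ k hk))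
    (((valL Ω).analyticAt _).fun_comp (M.analyticOnNhd_sol hΩ ψ k hk))

theorem analyticOnNhd_gradEnergy (hΩ : Bornology.IsBounded (Ω : Set (EuclideanSpace ℝ (Fin d))))
    (φ ψ : HHalf Ω) : AnalyticOnNhd ℂ (M.gradEnergy φ ψ) M.spectrumᶜ := by
  intro k hk
  rw [funext (M.gradEnergy_eq φ ψ)]
  refine Finset.analyticAt_fun_sum _ fun i _ => Finset.analyticAt_fun_sum _ fun j _ => ?_
  exact AnalyticAt.comp₂ ((mulL2L1 (vol Ω)).analyticAt_bilinear _)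
    (((mulL (vol Ω) (fun x => M.a x i j) ∘L gradL Ω j).analyticAt _).fun_comp
      (M.analyticOnNhd_sol hΩ φ k hk))
    (((gradL Ω i).analyticAt _).fun_comp (M.analyticOnNhd_sol hΩ ψ k hk))

end Coeff

/-- The identity theorem off a set of real numbers that omits `-1`. -/
theorem eqOn_compl_of_real {F : Type*} [NormedAddCommGroup F] [NormedSpace ℂ F] {S : Set ℂ}
    (hS : ∀ z ∈ S, z.im = 0) (h1 : -1 ∉ S) {f g : ℂ → F} (hf : AnalyticOnNhd ℂ f Sᶜ)
    (hg : AnalyticOnNhd ℂ g Sᶜ) {κ : ℕ → ℂ} {k₀ : ℂ} (hk₀ : k₀ ∈ Sᶜ) (hne : ∀ l, κ l ≠ k₀)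
    (hκ : Tendsto κ atTop (𝓝 k₀)) (hfg : ∀ l, f (κ l) = g (κ l)) : Set.EqOn f g Sᶜ :=
  hf.eqOn_of_preconnected_of_frequently_eq hg (isPreconnected_compl_of_real hS h1) hk₀
    ((tendsto_nhdsWithin_iff.2 ⟨hκ, Eventually.of_forall hne⟩).frequently
      (Frequently.of_forall hfg))

end Helmholtz

theorem theorem3p6 {d : ℕ} (hd : 1 ≤ d) (Ω : Opens (EuclideanSpace ℝ (Fin d)))
    (hΩ : Bornology.IsBounded (Ω : Set (EuclideanSpace ℝ (Fin d))))
    (M : Helmholtz.Coeff Ω) :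
    -- the domain `ℂ ∖ Σ` is open, and the solutions that enter the energies are well defined on it
    IsClosed M.spectrum ∧
    (∀ k ∈ M.spectrumᶜ, ∀ φ : Helmholtz.HHalf Ω, ∃! u, M.IsSolution k φ u) ∧
    ∀ (φ : Fin 2 → Helmholtz.HHalf Ω) (i j : Fin 2),
      -- the internal energies are analytic
      AnalyticOnNhd ℂ (M.energy (φ i) (φ j)) M.spectrumᶜ ∧
      AnalyticOnNhd ℂ (M.gradEnergy (φ i) (φ j)) M.spectrumᶜ ∧
      -- each is the only analytic function on `ℂ ∖ Σ` with its values at the given frequencies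
      (∀ (κ : ℕ → ℂ) (k₀ : ℂ), (∀ l, κ l ∈ M.spectrumᶜ) → k₀ ∈ M.spectrumᶜ →
        (∀ l, κ l ≠ k₀) → Tendsto κ atTop (𝓝 k₀) →
        ∀ F : ℂ → Lp ℂ 1 (Helmholtz.vol Ω), AnalyticOnNhd ℂ F M.spectrumᶜ →
          ((∀ l, F (κ l) = M.energy (φ i) (φ j) (κ l)) →
            ∀ k ∈ M.spectrumᶜ, F k = M.energy (φ i) (φ j) k) ∧
          ((∀ l, F (κ l) = M.gradEnergy (φ i) (φ j) (κ l)) →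
            ∀ k ∈ M.spectrumᶜ, F k = M.gradEnergy (φ i) (φ j) k)) ∧
      -- two media with the same energies at the given frequencies have the same energies
      (∀ (M' : Helmholtz.Coeff Ω) (κ : ℕ → ℂ) (k₀ : ℂ),
        (∀ l, κ l ∈ (M.spectrum ∪ M'.spectrum)ᶜ) → k₀ ∈ (M.spectrum ∪ M'.spectrum)ᶜ →
        (∀ l, κ l ≠ k₀) → Tendsto κ atTop (𝓝 k₀) →
          ((∀ l, M'.energy (φ i) (φ j) (κ l) = M.energy (φ i) (φ j) (κ l)) →
            ∀ k ∈ (M.spectrum ∪ M'.spectrum)ᶜ,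
              M'.energy (φ i) (φ j) k = M.energy (φ i) (φ j) k) ∧
          ((∀ l, M'.gradEnergy (φ i) (φ j) (κ l) = M.gradEnergy (φ i) (φ j) (κ l)) →
            ∀ k ∈ (M.spectrum ∪ M'.spectrum)ᶜ,
              M'.gradEnergy (φ i) (φ j) k = M.gradEnergy (φ i) (φ j) k)) := by
  have hS := fun (N : Helmholtz.Coeff Ω) z (hz : z ∈ N.spectrum) => N.spectrum_subset_real hz
  refine ⟨M.isClosed_spectrum hΩ, fun k hk φ => ⟨M.sol k φ, M.isSolution_sol hΩ hk φ,
    fun u hu => M.isSolution_unique hk hu (M.isSolution_sol hΩ hk φ)⟩, fun φ i j => ?_⟩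
  refine ⟨M.analyticOnNhd_energy hΩ _ _, M.analyticOnNhd_gradEnergy hΩ _ _, ?_, ?_⟩
  · intro κ k₀ _ hk₀ hne hκ F hF
    exact ⟨fun h => Helmholtz.eqOn_compl_of_real (hS M) M.neg_one_notMem_spectrum hF
        (M.analyticOnNhd_energy hΩ _ _) hk₀ hne hκ h,
      fun h => Helmholtz.eqOn_compl_of_real (hS M) M.neg_one_notMem_spectrum hF
        (M.analyticOnNhd_gradEnergy hΩ _ _) hk₀ hne hκ h⟩
  · intro M' κ k₀ _ hk₀ hne hκ
    have hSS : ∀ z ∈ M.spectrum ∪ M'.spectrum, z.im = 0 :=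
      fun z hz => hz.elim (hS M z) (hS M' z)
    have h1 : -1 ∉ M.spectrum ∪ M'.spectrum := fun h =>
      h.elim M.neg_one_notMem_spectrum M'.neg_one_notMem_spectrum
    have hl : (M.spectrum ∪ M'.spectrum)ᶜ ⊆ M.spectrumᶜ :=
      Set.compl_subset_compl.2 Set.subset_union_left
    have hr : (M.spectrum ∪ M'.spectrum)ᶜ ⊆ M'.spectrumᶜ :=
      Set.compl_subset_compl.2 Set.subset_union_right
    exact ⟨fun h => Helmholtz.eqOn_compl_of_real hSS h1 ((M'.analyticOnNhd_energy hΩ _ _).mono hr)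
        ((M.analyticOnNhd_energy hΩ _ _).mono hl) hk₀ hne hκ h,
      fun h => Helmholtz.eqOn_compl_of_real hSS h1 ((M'.analyticOnNhd_gradEnergy hΩ _ _).mono hr)
        ((M.analyticOnNhd_gradEnergy hΩ _ _).mono hl) hk₀ hne hκ h⟩
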